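/- For a discrete group $G$ let $C^n_b(G)$ be the space of bounded functions $G^n\to\mathbb{R}$, with the coboundary $$\delta^n f(g_1,\dots,g_{n+1}) = f(g_2,\dots,g_{n+1})+\sum_{i=1}^n(-1)^i f(g_1,\dots,g_ig_{i+1},\dots,g_{n+1})+(-1)^{n+1}f(g_1,\dots,g_n),$$ let $H^n_b(G)$ be the resulting bounded cohomology (bounded cocycles modulo coboundaries of bounded cochains), and let $\smile$ be the cup product $[f]\smile[f']=[f\smile f']$ induced by $(f\smile f')(g_1,\dots,g_{n+m})=f(g_1,\dots,g_n)f'(g_{n+1},\dots,g_{n+m})$. Let $Q(G)$ be the space of quasimorphisms, i.e. of maps $\varphi:G\to\mathbb{R}$ for which $\delta^1\varphi(g,h)=\varphi(g)+\varphi(h)-\varphi(gh)$ is bounded; then $[\delta^1\varphi]\in H^2_b(G)$. Let $F$ be a non-abelian free group of finite rank with a fixed basis $S$, let $|\cdot|$ be the word length, and call a product $g_1\cdots g_k$ reduced if $|g_1\cdots g_k|=|g_1|+\cdots+|g_k|$. A function $f$ is alternating if $f(x^{-1})=-f(x)$. Let $\iota:F\to F*F$, $\iota(g)=\iota_1(g)\iota_2(g)$,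 where $\iota_1,\iota_2$ are the two canonical inclusions; for $\varphi\in Q(F*F)$ one has $\varphi\circ\iota\in Q(F)$. **Decompositions.** For a finite sequence $x=(x_1,\dots,x_k)$ in $F$ put $x^{-1}=(x_k^{-1},\dots,x_1^{-1})$. Let $\mathcal{P}\subset F\setminus\{1\}$ be symmetric. A decomposition of $F$ with pieces $\mathcal{P}$ is a map $\Delta$ from $F$ to finite sequences in $\mathcal{P}$, with $\Delta(1)$ empty, such that: (1) if $\Delta(g)=(g_1,\dots,g_k)$ then $g=g_1\cdots g_k$ as a reduced product; (2) $\Delta(g^{-1})=\Delta(g)^{-1}$; (3) if $\Delta(g)=(g_1,\dots,g_k)$ then $\Delta(g_i\cdots g_j)=(g_i,\dots,g_j)$ for $1\le i\le j\le k$; (4) there is $D\ge 0$ such that for all $g,h\in F$ the following holds: let $c_1^{-1}$ be the longest common initial segment of $\Delta(g)$ and $\Delta(gh)$, $c_2$ the longest common final segment of $\Delta(g)$ and $\Delta(h^{-1})$, and $c_3$ the longest common final segment of $\Delta(h)$ and $\Delta(gh)$; then in $\Delta(g)=c_1^{-1}\cdot r_1\cdot c_2$, $\Delta(h)=c_2^{-1}\cdot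 r_2\cdot c_3$, $\Delta(gh)=c_1^{-1}\cdot r_3^{-1}\cdot c_3$ the sequences $r_1,r_2,r_3$ have length at most $D$. A map $\varphi:F\to\mathbb{R}$ is $\Delta$-decomposable if there is a bounded alternating $\lambda:\mathcal{P}\to\mathbb{R}$ with $\varphi(g)=\sum_{j}\lambda(g_j)$ whenever $\Delta(g)=(g_1,\dots,g_k)$. **Rolli quasimorphisms.** A Rolli quasimorphism is a map $\varphi:F\to\mathbb{R}$ of the form $\varphi(s_1^{m_1}\cdots s_k^{m_k})=\sum_j\lambda_{s_j}(m_j)$ (with $s_j\in S$, $s_j\neq s_{j+1}$, $m_j\in\mathbb{Z}\setminus\{0\}$), where each $\lambda_s:\mathbb{Z}\to\mathbb{R}$ ($s\in S$) is bounded and alternating. **The space $\Sigma_{Ind}$.** Two reduced words overlap if one of them is a proper subword of the other, or if they can be written as reduced products $xy$ and $yz$ (in one of the two orders) with $x,y,z$ non-empty. Let $\mathcal{N}$ be the set of words that do not overlap themselves, and let $\mathcal{N}^+\subset\mathcal{N}$ contain precisely one of $w,w^{-1}$ for every $1\ne w\in\mathcal{N}$. A family $I\subset F$ is independent if no two (possibly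 equal) words in $I$ overlap, and symmetric if $I=I^{-1}$. For $w\in F$ let $h_w(g)=c_w(g)-c_{w^{-1}}(g)$, where $c_w(g)$ is the maximal number of pairwise disjoint occurrences of $w$ as a subword of $g$. Then $\Sigma_{Ind}$ is the space of the functions $\sum_{w\in\mathcal{N}^+}\alpha_wh_w$ on $F$ with $\alpha=\alpha_1+\cdots+\alpha_n$, where each $\alpha_i:F\to\mathbb{R}$ is bounded, alternating and supported on some symmetric independent family. **Theorem.** Suppose that for all $\varphi,\psi\in Q(F*F)$ with $[\delta^1\varphi]\smile[\delta^1\psi]=0\in H^4_b(F*F)$ one has $[\delta^1(\varphi\circ\iota)]\smile[\delta^1(\psi\circ\iota)]=0\in H^4_b(F)$. Then: 1. for every decomposition $\Delta$ of $F$, every $\Delta$-decomposable map $\varphi$ is a quasimorphism, and $[\delta^1\varphi]\smile[\delta^1\psi]=0\in H^4_b(F)$ for every $\psi\in Q(F)$; 2. every $\varphi\in\Sigma_{Ind}$ is a quasimorphism, and $[\delta^1\varphi]\smile[\delta^1\psi]=0\in H^4_b(F)$ for every $\psi\in Q(F)$; 3. every Rolli quasimorphism $\varphi$ is indeed a quasimorphism,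 and $[\delta^1\varphi]\smile[\delta^1\psi]=0\in H^4_b(F)$ for every $\psi\in Q(F)$. -/

import Mathlib

/-! ### Bounded cohomology of a discrete group with trivial real coefficients -/

namespace BoundedCohomology

variable {G : Type*}

/-- Bounded inhomogeneous `n`-cochains: bounded functions `Gⁿ → ℝ`. -/
def boundedCochains (G : Type*) (n : ℕ) : Submodule ℝ ((Fin n → G) → ℝ) where
  carrier := {f | ∃ C : ℝ, ∀ g, |f g| ≤ C}
  zero_mem' := ⟨0, fun g => by simp⟩
  add_mem' := by
    rintro f f' ⟨C, hC⟩ ⟨C', hC'⟩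
    exact ⟨C + C', fun g => (abs_add_le _ _).trans (add_le_add (hC g) (hC' g))⟩
  smul_mem' := by
    rintro c f ⟨C, hC⟩
    refine ⟨|c| * C, fun g => ?_⟩
    rw [Pi.smul_apply, smul_eq_mul, abs_mul]
    exact mul_le_mul_of_nonneg_left (hC g) (abs_nonneg c)

/-- The coboundary of the bar resolution,
`δf(g₁,…,gₙ₊₁) = f(g₂,…,gₙ₊₁) + ∑ᵢ (-1)ⁱ f(…,gᵢgᵢ₊₁,…) + (-1)ⁿ⁺¹ f(g₁,…,gₙ)`;
the last summand of the sum below (`j = n`) is the term that forgets `gₙ₊₁`. -/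
def coboundary (G : Type*) [Group G] (n : ℕ) :
    ((Fin n → G) → ℝ) →ₗ[ℝ] ((Fin (n + 1) → G) → ℝ) where
  toFun f g := f (fun i => g i.succ) +
    ∑ j : Fin (n + 1), (-1 : ℝ) ^ ((j : ℕ) + 1) * f (Fin.contractNth j (· * ·) g)
  map_add' f f' := by
    ext g
    simp only [Pi.add_apply, mul_add, Finset.sum_add_distrib]
    ring
  map_smul' c f := by
    ext g
    simp only [Pi.smul_apply, smul_eq_mul, RingHom.id_apply, mul_add, Finset.mul_sum]
    congr 1
    exact Finset.sum_congr rfl fun j _ => by ring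

theorem coboundary_apply [Group G] {n : ℕ} (f : (Fin n → G) → ℝ) (g : Fin (n + 1) → G) :
    coboundary G n f g = f (fun i => g i.succ) +
      ∑ j : Fin (n + 1), (-1 : ℝ) ^ ((j : ℕ) + 1) * f (Fin.contractNth j (· * ·) g) := rfl

/-- Bounded cocycles `Zⁿ_b(G)`. -/
def boundedCocycles (G : Type*) [Group G] (n : ℕ) : Submodule ℝ ((Fin n → G) → ℝ) :=
  boundedCochains G n ⊓ LinearMap.ker (coboundary G n)

/-- Bounded coboundaries `Bⁿ_b(G)`: coboundaries of *bounded* cochains. -/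
def boundedCoboundaries (G : Type*) [Group G] : (n : ℕ) → Submodule ℝ ((Fin n → G) → ℝ)
  | 0 => ⊥
  | n + 1 => (boundedCochains G n).map (coboundary G n)

/-- Bounded cohomology `Hⁿ_b(G) = Zⁿ_b(G) / Bⁿ_b(G)`. -/
abbrev Hb (G : Type*) [Group G] (n : ℕ) : Type _ :=
  boundedCocycles G n ⧸ (boundedCoboundaries G n).submoduleOf (boundedCocycles G n)

/-! The cup product.  The total degree is a separate variable `k` with a proof of `n + m = k`, so
that degrees which agree only up to reassociation can be compared. -/

/-- `(f ⌣ f')(g₁,…,gₖ) = f(g₁,…,gₙ) f'(gₙ₊₁,…,gₙ₊ₘ)`. -/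
def cupCochain {n m k : ℕ} (h : n + m = k) (f : (Fin n → G) → ℝ) (f' : (Fin m → G) → ℝ) :
    (Fin k → G) → ℝ := fun g =>
  f (fun i => g ⟨i, by omega⟩) * f' (fun i => g ⟨n + i, by omega⟩)

theorem cupCochain_bounded {n m k : ℕ} (h : n + m = k) {f : (Fin n → G) → ℝ}
    {f' : (Fin m → G) → ℝ} (hf : f ∈ boundedCochains G n) (hf' : f' ∈ boundedCochains G m) :
    cupCochain h f f' ∈ boundedCochains G k := by
  obtain ⟨C, hC⟩ := hf
  obtain ⟨C', hC'⟩ := hf'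
  refine ⟨C * C', fun g => ?_⟩
  rw [cupCochain, abs_mul]
  exact mul_le_mul (hC _) (hC' _) (abs_nonneg _) ((abs_nonneg _).trans (hC fun i => g ⟨i, by omega⟩))

/-- The Leibniz rule `δ(f ⌣ f') = δf ⌣ f' + (-1)ⁿ f ⌣ δf'`. -/
theorem coboundary_cupCochain [Group G] {n m k : ℕ} (h : n + m = k)
    (f : (Fin n → G) → ℝ) (f' : (Fin m → G) → ℝ) :
    coboundary G k (cupCochain h f f') =
      cupCochain (by omega : n + 1 + m = k + 1) (coboundary G n f) f' +
        (-1 : ℝ) ^ n • cupCochain (by omega : n + (m + 1) = k + 1) f (coboundary G m f') := by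
  subst h
  ext g
  simp only [coboundary_apply, cupCochain, Pi.add_apply, Pi.smul_apply, smul_eq_mul]
  have key : ∑ j : Fin (n + m + 1), (-1 : ℝ) ^ ((j : ℕ) + 1) *
      (f (fun i => Fin.contractNth j (· * ·) g ⟨i, by omega⟩) *
        f' (fun i => Fin.contractNth j (· * ·) g ⟨n + i, by omega⟩)) =
      ∑ j : Fin n, (-1 : ℝ) ^ ((j : ℕ) + 1) *
        (f (fun i => Fin.contractNth (⟨j, by omega⟩ : Fin (n + m + 1)) (· * ·) g ⟨i, by omega⟩) *
        f' (fun i => Fin.contractNth (⟨j, by omega⟩ : Fin (n + m + 1)) (· * ·) g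
          ⟨n + i, by omega⟩)) +
      ∑ j : Fin (m + 1), (-1 : ℝ) ^ (n + (j : ℕ) + 1) *
        (f (fun i => Fin.contractNth (⟨n + j, by omega⟩ : Fin (n + m + 1)) (· * ·) g
          ⟨i, by omega⟩) *
        f' (fun i => Fin.contractNth (⟨n + j, by omega⟩ : Fin (n + m + 1)) (· * ·) g
          ⟨n + i, by omega⟩)) :=
    Fin.sum_univ_add (a := n) (b := m + 1) _
  rw [key, Fin.sum_univ_castSucc (n := n)]
  have e1 : ∀ j : Fin n,
      (fun i : Fin n => Fin.contractNth (⟨j, by omega⟩ : Fin (n + m + 1)) (· * ·) g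
        ⟨i, by omega⟩) =
      Fin.contractNth j.castSucc (· * ·) (fun i : Fin (n + 1) => g ⟨i, by omega⟩) := by
    intro j; ext i; simp [Fin.contractNth]
  have e2 : ∀ j : Fin n,
      (fun i : Fin m => Fin.contractNth (⟨j, by omega⟩ : Fin (n + m + 1)) (· * ·) g
        ⟨n + i, by omega⟩) = fun i : Fin m => g ⟨n + 1 + i, by omega⟩ := by
    intro j; ext i
    rw [Fin.contractNth_apply_of_gt _ _ _ _ (by simp; omega)]
    congr 1; ext; simp; omega
  have e3 : ∀ j : Fin (m + 1),
      (fun i : Fin n => Fin.contractNth (⟨n + j, by omega⟩ : Fin (n + m + 1)) (· * ·) g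
        ⟨i, by omega⟩) = fun i : Fin n => g ⟨i, by omega⟩ := by
    intro j; ext i
    rw [Fin.contractNth_apply_of_lt _ _ _ _ (by simp; omega)]
    rfl
  have e4 : ∀ j : Fin (m + 1),
      (fun i : Fin m => Fin.contractNth (⟨n + j, by omega⟩ : Fin (n + m + 1)) (· * ·) g
        ⟨n + i, by omega⟩) =
      Fin.contractNth j (· * ·) (fun i : Fin (m + 1) => g ⟨n + i, by omega⟩) := by
    intro j; ext i; simp [Fin.contractNth, add_assoc]
  have e5 : Fin.contractNth (Fin.last n) (· * ·) (fun i : Fin (n + 1) => g ⟨i, by omega⟩) =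
      fun i : Fin n => g ⟨i, by omega⟩ := by
    ext i
    rw [Fin.contractNth_apply_of_lt _ _ _ _ (by simp)]
    rfl
  have e6 : (fun i : Fin m => g (Fin.succ (⟨n + i, by omega⟩ : Fin (n + m)))) =
      fun i : Fin m => g ⟨n + 1 + i, by omega⟩ := by
    ext i; congr 1; ext; simp; omega
  have e7 : (fun i : Fin m => g ⟨n + (i.succ : Fin (m + 1)), by omega⟩) =
      fun i : Fin m => g ⟨n + 1 + i, by omega⟩ := by
    ext i; congr 1; ext; simp; omega
  simp only [e1, e2, e3, e4, e5, e6, e7, Fin.val_castSucc, Fin.val_last, mul_add, add_mul,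
    Finset.sum_mul, Finset.mul_sum]
  have e8 : (fun i : Fin n => g (Fin.succ (⟨i, by omega⟩ : Fin (n + m)))) =
      fun i : Fin n => g ⟨(i.succ : Fin (n + 1)), by omega⟩ := by
    ext i; rfl
  have s1 : ∀ x : Fin n, (-1 : ℝ) ^ ((x : ℕ) + 1) *
      (f (Fin.contractNth x.castSucc (· * ·) (fun i : Fin (n + 1) => g ⟨i, by omega⟩)) *
        f' fun i : Fin m => g ⟨n + 1 + i, by omega⟩) = (-1 : ℝ) ^ ((x : ℕ) + 1) *
      f (Fin.contractNth x.castSucc (· * ·) (fun i : Fin (n + 1) => g ⟨i, by omega⟩)) *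
        f' fun i : Fin m => g ⟨n + 1 + i, by omega⟩ := fun x => by ring
  have s2 : ∀ x : Fin (m + 1), (-1 : ℝ) ^ (n + (x : ℕ) + 1) *
      ((f fun i : Fin n => g ⟨i, by omega⟩) *
        f' (Fin.contractNth x (· * ·) (fun i : Fin (m + 1) => g ⟨n + i, by omega⟩))) =
      (-1 : ℝ) ^ n * ((f fun i : Fin n => g ⟨i, by omega⟩) * ((-1 : ℝ) ^ ((x : ℕ) + 1) *
        f' (Fin.contractNth x (· * ·) (fun i : Fin (m + 1) => g ⟨n + i, by omega⟩)))) :=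
    fun x => by ring
  simp only [s1, s2, e8]
  ring

theorem cupCochain_cocycle [Group G] {n m k : ℕ} (h : n + m = k) {f : (Fin n → G) → ℝ}
    {f' : (Fin m → G) → ℝ} (hf : f ∈ boundedCocycles G n) (hf' : f' ∈ boundedCocycles G m) :
    cupCochain h f f' ∈ boundedCocycles G k := by
  refine Submodule.mem_inf.2 ⟨cupCochain_bounded h hf.1 hf'.1, LinearMap.mem_ker.2 ?_⟩
  rw [coboundary_cupCochain, LinearMap.mem_ker.1 hf.2, LinearMap.mem_ker.1 hf'.2]
  ext g
  simp [cupCochain]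

theorem cupCochain_coboundary_left [Group G] {n m k : ℕ} (h : n + m = k) {f : (Fin n → G) → ℝ}
    {f' : (Fin m → G) → ℝ} (hf : f ∈ boundedCoboundaries G n) (hf' : f' ∈ boundedCocycles G m) :
    cupCochain h f f' ∈ boundedCoboundaries G k := by
  cases n with
  | zero =>
    rw [(Submodule.mem_bot ℝ).1 hf]
    convert (boundedCoboundaries G k).zero_mem
    ext g
    simp [cupCochain]
  | succ n =>
    obtain ⟨e, he, rfl⟩ := hf
    obtain ⟨k, rfl⟩ : ∃ k', k = k' + 1 := ⟨n + m, by omega⟩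
    have h' : n + m = k := by omega
    refine ⟨cupCochain h' e f', cupCochain_bounded h' he hf'.1, ?_⟩
    rw [coboundary_cupCochain, LinearMap.mem_ker.1 hf'.2]
    ext g
    simp [cupCochain]

theorem cupCochain_coboundary_right [Group G] {n m k : ℕ} (h : n + m = k) {f : (Fin n → G) → ℝ}
    {f' : (Fin m → G) → ℝ} (hf : f ∈ boundedCocycles G n) (hf' : f' ∈ boundedCoboundaries G m) :
    cupCochain h f f' ∈ boundedCoboundaries G k := by
  cases m with
  | zero =>
    rw [(Submodule.mem_bot ℝ).1 hf']
    convert (boundedCoboundaries G k).zero_mem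
    ext g
    simp [cupCochain]
  | succ m =>
    obtain ⟨e, he, rfl⟩ := hf'
    obtain ⟨k, rfl⟩ : ∃ k', k = k' + 1 := ⟨n + m, by omega⟩
    have h' : n + m = k := by omega
    refine ⟨(-1 : ℝ) ^ n • cupCochain h' f e,
      (boundedCochains G k).smul_mem _ (cupCochain_bounded h' hf.1 he), ?_⟩
    rw [map_smul, coboundary_cupCochain, LinearMap.mem_ker.1 hf.2]
    ext g
    simp [cupCochain, ← mul_assoc, ← mul_pow]

/-- The cup product of bounded cocycles, with values in bounded cohomology. -/
def cupCocycle (G : Type*) [Group G] (n m : ℕ) :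
    boundedCocycles G n →ₗ[ℝ] boundedCocycles G m →ₗ[ℝ] Hb G (n + m) :=
  LinearMap.mk₂ ℝ
    (fun f f' => Submodule.Quotient.mk
      ⟨cupCochain rfl f.1 f'.1, cupCochain_cocycle rfl f.2 f'.2⟩)
    (fun f₁ f₂ f' => by
      rw [← Submodule.Quotient.mk_add]; congr 1; ext g; simp [cupCochain, add_mul])
    (fun c f f' => by
      rw [← Submodule.Quotient.mk_smul]; congr 1; ext g; simp [cupCochain, mul_assoc])
    (fun f f'₁ f'₂ => by
      rw [← Submodule.Quotient.mk_add]; congr 1; ext g; simp [cupCochain, mul_add])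
    (fun c f f' => by
      rw [← Submodule.Quotient.mk_smul]; congr 1; ext g; simp [cupCochain, mul_left_comm])

/-- The cup product `⌣ : Hⁿ_b(G) × Hᵐ_b(G) → Hⁿ⁺ᵐ_b(G)`, `[f] ⌣ [f'] = [f ⌣ f']`. -/
def cup {G : Type*} [Group G] {n m : ℕ} : Hb G n →ₗ[ℝ] Hb G m →ₗ[ℝ] Hb G (n + m) :=
  Submodule.liftQ _
    (LinearMap.flip (Submodule.liftQ _ (cupCocycle G n m).flip (by
      intro f' hf'
      refine LinearMap.mem_ker.2 (LinearMap.ext fun f => ?_)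
      exact (Submodule.Quotient.mk_eq_zero _).2 (cupCochain_coboundary_right rfl f.2 hf'))))
    (by
      intro f hf
      refine LinearMap.mem_ker.2 (LinearMap.ext fun b => ?_)
      induction b using Submodule.Quotient.induction_on with
      | H f' => exact (Submodule.Quotient.mk_eq_zero _).2 (cupCochain_coboundary_left rfl hf f'.2))

theorem cup_mk {G : Type*} [Group G] {n m : ℕ} (f : boundedCocycles G n)
    (f' : boundedCocycles G m) :
    cup (Submodule.Quotient.mk f : Hb G n) (Submodule.Quotient.mk f' : Hb G m) =
      Submodule.Quotient.mk ⟨cupCochain rfl f.1 f'.1, cupCochain_cocycle rfl f.2 f'.2⟩ := rfl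

/-! ### Quasimorphisms -/

/-- The space `Q(G)` of quasimorphisms of `G`. -/
def Quasimorphisms (G : Type*) [Group G] : Submodule ℝ (G → ℝ) where
  carrier := {φ | ∃ D : ℝ, ∀ g h, |φ g + φ h - φ (g * h)| ≤ D}
  zero_mem' := ⟨0, fun g h => by simp⟩
  add_mem' := by
    rintro φ ψ ⟨D, hD⟩ ⟨D', hD'⟩
    refine ⟨D + D', fun g h => ?_⟩
    have e : (φ + ψ) g + (φ + ψ) h - (φ + ψ) (g * h) =
        (φ g + φ h - φ (g * h)) + (ψ g + ψ h - ψ (g * h)) := by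
      simp only [Pi.add_apply]; ring
    rw [e]
    exact (abs_add_le _ _).trans (add_le_add (hD g h) (hD' g h))
  smul_mem' := by
    rintro c φ ⟨D, hD⟩
    refine ⟨|c| * D, fun g h => ?_⟩
    have e : (c • φ) g + (c • φ) h - (c • φ) (g * h) = c * (φ g + φ h - φ (g * h)) := by
      simp only [Pi.smul_apply, smul_eq_mul]; ring
    rw [e, abs_mul]
    exact mul_le_mul_of_nonneg_left (hD g h) (abs_nonneg c)

theorem coboundary_one [Group G] (φ : G → ℝ) (g : Fin 2 → G) :
    coboundary G 1 (fun x => φ (x 0)) g = φ (g 0) + φ (g 1) - φ (g 0 * g 1) := by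
  rw [coboundary_apply, Fin.sum_univ_two]
  simp [Fin.contractNth]
  ring

theorem coboundary_quasimorphism_mem [Group G] (φ : Quasimorphisms G) :
    coboundary G 1 (fun x => φ.1 (x 0)) ∈ boundedCocycles G 2 := by
  obtain ⟨D, hD⟩ := φ.2
  refine Submodule.mem_inf.2 ⟨⟨D, fun g => ?_⟩, LinearMap.mem_ker.2 ?_⟩
  · rw [coboundary_one]
    exact hD _ _
  · ext g
    rw [coboundary_apply, Fin.sum_univ_three]
    simp [coboundary_one, Fin.contractNth, mul_assoc]
    ring

/-- The class `[δ¹φ] ∈ H²_b(G)` of a quasimorphism `φ`. -/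
def deltaClass {G : Type*} [Group G] (φ : Quasimorphisms G) : Hb G 2 :=
  Submodule.Quotient.mk ⟨coboundary G 1 (fun x => φ.1 (x 0)), coboundary_quasimorphism_mem φ⟩

/-! ### The map `ι` -/

/-- `ι : G → G * G`, `g ↦ ι₁(g) ι₂(g)`. -/
def iota (G : Type*) [Group G] (g : G) : Monoid.Coprod G G :=
  Monoid.Coprod.inl g * Monoid.Coprod.inr g

/-- `ι` is a quasihomomorphism: it pulls quasimorphisms back to quasimorphisms. -/
theorem comp_iota_mem {G : Type*} [Group G] (φ : Quasimorphisms (Monoid.Coprod G G)) :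
    φ.1 ∘ iota G ∈ Quasimorphisms G := by
  obtain ⟨D, hD⟩ := φ.2
  refine ⟨9 * D, fun g h => ?_⟩
  simp only [Function.comp_apply, iota, map_mul]
  set a := (Monoid.Coprod.inl g : Monoid.Coprod G G)
  set b := (Monoid.Coprod.inr g : Monoid.Coprod G G)
  set c := (Monoid.Coprod.inl h : Monoid.Coprod G G)
  set d := (Monoid.Coprod.inr h : Monoid.Coprod G G)
  have h1 := abs_le.1 (hD a b)
  have h2 := abs_le.1 (hD c d)
  have h3 := abs_le.1 (hD (a * c) (b * d))
  have h4 := abs_le.1 (hD a c)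
  have h5 := abs_le.1 (hD b d)
  rw [abs_le]
  constructor <;> linarith [h1.1, h1.2, h2.1, h2.2, h3.1, h3.2, h4.1, h4.2, h5.1, h5.2]

/-- The pullback `φ ∘ ι ∈ Q(G)` of `φ ∈ Q(G * G)`. -/
def compIota {G : Type*} [Group G] (φ : Quasimorphisms (Monoid.Coprod G G)) :
    Quasimorphisms G :=
  ⟨φ.1 ∘ iota G, comp_iota_mem φ⟩

end BoundedCohomology

/-! ### Decompositions of a free group -/

namespace FreeDecomposition

/-- The longest common initial segment of two sequences. -/
def commonPrefix {X : Type*} [DecidableEq X] : List X → List X → List X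
  | a :: l, b :: m => if a = b then a :: commonPrefix l m else []
  | _, _ => []

/-- The longest common final segment of two sequences. -/
def commonSuffix {X : Type*} [DecidableEq X] (l m : List X) : List X :=
  (commonPrefix l.reverse m.reverse).reverse

/-- The sequence `x⁻¹ = (xₙ⁻¹, …, x₁⁻¹)`. -/
def invSeq {G : Type*} [Group G] (x : List G) : List G := (x.map (·⁻¹)).reverse

section Triangle

variable {G : Type*} [Group G] [DecidableEq G] (Δ : G → List G) (g h : G)

/-! The `Δ`-triangle of `g, h`:
`Δ(g) = c₁⁻¹ · r₁ · c₂`, `Δ(h) = c₂⁻¹ · r₂ · c₃`, `Δ(gh) = c₁⁻¹ · r₃⁻¹ · c₃`. -/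

/-- `c₁⁻¹`: the largest sequence at the beginning of both `Δ(g)` and `Δ(gh)`. -/
def c₁Inv : List G := commonPrefix (Δ g) (Δ (g * h))

/-- `c₂`: the largest sequence at the end of both `Δ(g)` and `Δ(h⁻¹)`. -/
def c₂ : List G := commonSuffix (Δ g) (Δ h⁻¹)

/-- `c₃`: the largest sequence at the end of both `Δ(h)` and `Δ(gh)`. -/
def c₃ : List G := commonSuffix (Δ h) (Δ (g * h))

/-- What remains of `Δ(g)` after removing `c₁⁻¹` on the left and `c₂` on the right. -/
def r₁ : List G := ((Δ g).drop (c₁Inv Δ g h).length).rdrop (c₂ Δ g h).length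

/-- What remains of `Δ(h)` after removing `c₂⁻¹` on the left and `c₃` on the right. -/
def r₂ : List G := ((Δ h).drop (c₂ Δ g h).length).rdrop (c₃ Δ g h).length

/-- The inverse of what remains of `Δ(gh)` after removing `c₁⁻¹` on the left and `c₃` on the
right. -/
def r₃ : List G :=
  invSeq (((Δ (g * h)).drop (c₁Inv Δ g h).length).rdrop (c₃ Δ g h).length)

end Triangle

/-- A decomposition of the free group with basis `S`. -/
structure Decomposition (S : Type*) [DecidableEq S] where
  /-- The set of pieces. -/
  pieces : Set (FreeGroup S)
  inv_mem_pieces : ∀ p ∈ pieces, p⁻¹ ∈ pieces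
  one_notMem_pieces : (1 : FreeGroup S) ∉ pieces
  /-- The map `Δ`, with values in finite sequences of pieces. -/
  seq : FreeGroup S → List (FreeGroup S)
  seq_mem : ∀ g, ∀ p ∈ seq g, p ∈ pieces
  seq_one : seq 1 = []
  prod_seq : ∀ g, (seq g).prod = g
  /-- The product `g = g₁ ⋯ gₖ` is reduced: `|g| = |g₁| + ⋯ + |gₖ|`. -/
  norm_seq : ∀ g, ((seq g).map FreeGroup.norm).sum = g.norm
  seq_inv : ∀ g, seq g⁻¹ = invSeq (seq g)
  /-- `Δ` is infix closed. -/
  seq_infix : ∀ g, ∀ l : List (FreeGroup S), l <:+: seq g → seq l.prod = l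
  /-- The `r`-parts of all `Δ`-triangles have uniformly bounded length. -/
  defect_finite : ∃ D : ℕ, ∀ g h, (r₁ seq g h).length ≤ D ∧ (r₂ seq g h).length ≤ D ∧
    (r₃ seq g h).length ≤ D

/-- `φ` is `Δ`-decomposable: `φ(g) = ∑ⱼ lam(gⱼ)` where `Δ(g) = (g₁, …, gₖ)`, for a bounded
alternating function `lam` on the pieces (its values outside the pieces are irrelevant). -/
def Decomposition.IsDecomposable {S : Type*} [DecidableEq S] (Δ : Decomposition S)
    (φ : FreeGroup S → ℝ) : Prop :=
  ∃ lam : FreeGroup S → ℝ, (∃ C : ℝ, ∀ p ∈ Δ.pieces, |lam p| ≤ C) ∧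
    (∀ p ∈ Δ.pieces, lam p⁻¹ = -lam p) ∧ ∀ g, φ g = ((Δ.seq g).map lam).sum

/-- Rolli quasimorphisms: `φ(s_{i₁}^{m₁} ⋯ s_{iₖ}^{mₖ}) = ∑ⱼ lam_{iⱼ}(mⱼ)` whenever consecutive
`s_{iⱼ}` are distinct and all `mⱼ ≠ 0`, for bounded alternating functions `lam_i : ℤ → ℝ`. -/
def IsRolli {S : Type*} (φ : FreeGroup S → ℝ) : Prop :=
  ∃ lam : S → ℤ → ℝ, (∀ s, ∃ C : ℝ, ∀ m, |lam s m| ≤ C) ∧ (∀ s m, lam s (-m) = -lam s m) ∧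
    ∀ L : List (S × ℤ), (∀ p ∈ L, p.2 ≠ 0) → L.IsChain (fun p q => p.1 ≠ q.1) →
      φ (L.map fun p => FreeGroup.of p.1 ^ p.2).prod = (L.map fun p => lam p.1 p.2).sum

/-! ### Brooks quasimorphisms and the space `Σ_Ind` -/

section Brooks

variable {S : Type*} [DecidableEq S]

/-- `w` occurs as a subword of `g` starting after the first `i` letters. -/
def OccursAt (w g : FreeGroup S) (i : ℕ) : Prop :=
  ∃ u v, u.length = i ∧ g.toWord = u ++ w.toWord ++ v

/-- The small counting function: the maximal number of pairwise disjoint occurrences of `w` as a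
subword of `g`. -/
noncomputable def smallCount (w g : FreeGroup S) : ℕ :=
  sSup {n | ∃ s : Finset ℕ, s.card = n ∧ (∀ i ∈ s, OccursAt w g i) ∧
    ∀ i ∈ s, ∀ j ∈ s, i < j → i + w.norm ≤ j}

/-- The small Brooks quasimorphism `h_w`. -/
noncomputable def brooks (w g : FreeGroup S) : ℝ := (smallCount w g : ℝ) - smallCount w⁻¹ g

/-- `w₁ = xy` and `w₂ = yz` as reduced products with `x, y, z` non-empty. -/
def OverlapLeft (w₁ w₂ : FreeGroup S) : Prop :=
  ∃ x y z, x ≠ [] ∧ y ≠ [] ∧ z ≠ [] ∧ w₁.toWord = x ++ y ∧ w₂.toWord = y ++ z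

/-- Two words overlap if they overlap properly or one is a proper subword of the other. -/
def Overlap (w₁ w₂ : FreeGroup S) : Prop :=
  OverlapLeft w₁ w₂ ∨ OverlapLeft w₂ w₁ ∨
    (w₁ ≠ w₂ ∧ (w₁.toWord <:+: w₂.toWord ∨ w₂.toWord <:+: w₁.toWord))

/-- The set `𝒩` of non-self-overlapping words. -/
def nonSelfOverlapping (S : Type*) [DecidableEq S] : Set (FreeGroup S) := {w | ¬ Overlap w w}

/-- A family is independent if no two (possibly equal) words in it overlap. -/
def Independent (I : Set (FreeGroup S)) : Prop := ∀ w ∈ I, ∀ w' ∈ I, ¬ Overlap w w'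

/-- `P ⊆ W` contains precisely one of `g, g⁻¹` for every `1 ≠ g ∈ W`. -/
def IsPositivePart (P W : Set (FreeGroup S)) : Prop :=
  P ⊆ W ∧ ∀ g ∈ W, g ≠ 1 → Xor (g ∈ P) (g⁻¹ ∈ P)

/-- The space `Σ_Ind`: the functions `φ_α = ∑_{w ∈ 𝒩⁺} α_w h_w` (at each `g` only finitely many
summands are nonzero) with `α = α₁ + ⋯ + αₙ`, where each `αᵢ` is bounded, alternating and supported
on a symmetric independent family. -/
def IsSigmaInd (φ : FreeGroup S → ℝ) : Prop :=
  ∃ (n : ℕ) (α : Fin n → FreeGroup S → ℝ) (P : Set (FreeGroup S)),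
    IsPositivePart P (nonSelfOverlapping S) ∧
    (∀ i, (∃ C : ℝ, ∀ w, |α i w| ≤ C) ∧ (∀ w, α i w⁻¹ = -α i w) ∧
      ∃ I : Set (FreeGroup S), (∀ w ∈ I, w⁻¹ ∈ I) ∧ Independent I ∧ Function.support (α i) ⊆ I) ∧
    ∀ g, φ g = ∑ᶠ w ∈ P, (∑ i, α i w) * brooks w g

end Brooks

end FreeDecomposition

/-! The special shape of `φ` matters only for showing that `φ` is a quasimorphism. Under the
hypothesis on `ι`, the cup product of any two classes `[δ¹φ]`, `[δ¹ψ]` vanishes, and this holds for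
every group `G` in place of `F`.

Replace `φ`, `ψ` by alternating representatives at bounded distance. On `G * G` let `Φ` be the sum
of `φ` over the syllables from the first factor and `Ψ` the sum of `ψ` over those from the second.
Since `ι(g)` has one syllable `g` in each factor, `Φ ∘ ι = φ` and `Ψ ∘ ι = ψ`. It remains to see
that `[δ¹Φ] ⌣ [δ¹Ψ] = 0` (`cupDefectTrivial_splitMap`). Weight each syllable `a` of `g = u a u'` by
its `φ`-value times the defect of `Ψ` on a triangle with apex `u`, and let `M(g, z, t)` be the sum.
Moving `u` by an element of the first factor does not change `Ψ(u⁻¹ z)`, so `M` is additive in `g`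
up to a bounded error (`abs_syllableSum_defect_le`). That error is a bounded primitive, because the
cocycle identity for `δ¹Ψ` removes the apex from the alternating sum of the `M`'s.

The quasimorphism property has three sources. Rolli maps are syllable sums on a free product of
infinite cyclic groups. For decomposable maps the common parts of a `Δ`-triangle cancel, leaving
boundedly many pieces. For `Σ_Ind`, distinct words with occurrences across the same cut overlap, so
independence leaves at most one word and its inverse that can contribute to the defect at a cut. -/

namespace FreeProduct

/-! ### Reduced syllable sequences and weighted syllable sums -/

open Monoid Monoid.CoprodI

variable {ι : Type*} {G : ι → Type*} [∀ i, Group (G i)]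

/-- The product in the free product of a sequence of syllables. -/
def syllableProd (L : List (Σ i, G i)) : CoprodI G := (L.map fun l => of l.2).prod

/-- A sequence of syllables is reduced if all syllables are nontrivial and consecutive syllables
come from distinct factors. -/
def IsReducedSeq (L : List (Σ i, G i)) : Prop :=
  (∀ l ∈ L, l.2 ≠ 1) ∧ (L.map Sigma.fst).IsChain (· ≠ ·)

theorem IsReducedSeq.nil : IsReducedSeq ([] : List (Σ i, G i)) := ⟨by simp, by simp⟩

theorem IsReducedSeq.of_append {L₁ L₂ : List (Σ i, G i)} (h : IsReducedSeq (L₁ ++ L₂)) :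
    IsReducedSeq L₁ ∧ IsReducedSeq L₂ := by
  obtain ⟨h1, h2⟩ := h
  rw [List.map_append] at h2
  exact ⟨⟨fun l hl => h1 l (by simp [hl]), h2.left_of_append⟩,
    ⟨fun l hl => h1 l (by simp [hl]), h2.right_of_append⟩⟩

theorem IsReducedSeq.tail {p : Σ i, G i} {L : List (Σ i, G i)} (h : IsReducedSeq (p :: L)) :
    IsReducedSeq L :=
  (IsReducedSeq.of_append (L₁ := [p]) h).2

theorem IsReducedSeq.append {L₁ L₂ : List (Σ i, G i)} {p q : Σ i, G i}
    (h₁ : IsReducedSeq (L₁ ++ [p])) (h₂ : IsReducedSeq (q :: L₂)) (hpq : p.1 ≠ q.1) :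
    IsReducedSeq (L₁ ++ [p] ++ q :: L₂) := by
  refine ⟨fun l hl => ?_, ?_⟩
  · rcases List.mem_append.1 hl with h | h
    exacts [h₁.1 l h, h₂.1 l h]
  · have h1 := h₁.2
    have h2 := h₂.2
    simp only [List.map_append, List.map_cons, List.map_nil, List.append_assoc, List.cons_append,
      List.nil_append] at h1 h2 ⊢
    exact List.isChain_append_cons_cons.2 ⟨h1, hpq, h2⟩

theorem IsReducedSeq.merge {L₁ L₂ : List (Σ i, G i)} {i : ι} {a b : G i}
    (h₁ : IsReducedSeq (L₁ ++ [⟨i, a⟩])) (h₂ : IsReducedSeq (⟨i, b⟩ :: L₂)) (hab : a * b ≠ 1) :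
    IsReducedSeq (L₁ ++ ⟨i, a * b⟩ :: L₂) := by
  refine ⟨fun l hl => ?_, ?_⟩
  · rcases List.mem_append.1 hl with h | h
    · exact h₁.1 l (by simp [h])
    · rcases List.mem_cons.1 h with rfl | h
      · exact hab
      · exact h₂.1 l (by simp [h])
  · have h1 := h₁.2
    have h2 := h₂.2
    simp only [List.map_append, List.map_cons, List.map_nil] at h1 h2 ⊢
    exact List.isChain_split.2 ⟨h1, h2⟩

/-- The sum of `φᵢ(a) f(u)` over the syllables `a ∈ Gᵢ` of the sequence, where `u` is the product
of the syllables before `a`. -/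
noncomputable def weightedSum (φ : ∀ i, G i → ℝ) :
    List (Σ i, G i) → (CoprodI G → ℝ) → ℝ
  | [], _ => 0
  | p :: L, f => φ p.1 p.2 * f 1 + weightedSum φ L fun u => f (of p.2 * u)

theorem weightedSum_append (φ : ∀ i, G i → ℝ) (L₁ L₂ : List (Σ i, G i)) (f : CoprodI G → ℝ) :
    weightedSum φ (L₁ ++ L₂) f =
      weightedSum φ L₁ f + weightedSum φ L₂ fun u => f (syllableProd L₁ * u) := by
  induction L₁ generalizing f with
  | nil => simp [weightedSum, syllableProd]
  | cons p L ih =>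
    simp only [List.cons_append, weightedSum, ih, syllableProd, List.map_cons, List.prod_cons,
      mul_assoc]
    ring

theorem weightedSum_linear (φ : ∀ i, G i → ℝ) (L : List (Σ i, G i)) (c : ℝ)
    (f f' : CoprodI G → ℝ) :
    weightedSum φ L (fun u => f u + c * f' u) = weightedSum φ L f + c * weightedSum φ L f' := by
  induction L generalizing f f' with
  | nil => simp [weightedSum]
  | cons p L ih =>
    simp only [weightedSum]
    rw [ih (fun u => f (of p.2 * u)) (fun u => f' (of p.2 * u))]
    ring

/-- Factorwise alternating quasimorphisms with a common bound `D` on their defects. -/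
structure IsAlternatingFamily (φ : ∀ i, G i → ℝ) (D : ℝ) : Prop where
  map_inv : ∀ i a, φ i a⁻¹ = -φ i a
  defect_le : ∀ i a b, |φ i a + φ i b - φ i (a * b)| ≤ D

/-- Inverse syllables at the junction cancel without cost because `φ` is alternating. The process
stops at the latest when two syllables merge into a nontrivial one, so at most one defect, weighted
by one value of `f`, is ever paid. Hypothesis `hf` ensures that the two junction syllables carry the
same weight. -/
theorem exists_isReducedSeq_mul {φ : ∀ i, G i → ℝ} {D K : ℝ} (hφ : IsAlternatingFamily φ D)
    (hD : 0 ≤ D) (f : CoprodI G → ℝ) (hK : ∀ u, |f u| ≤ K)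
    (hf : ∀ i (a b : G i) u, φ i b * f (u * of a) = φ i b * f u)
    (L₁ L₂ : List (Σ i, G i)) (h₁ : IsReducedSeq L₁) (h₂ : IsReducedSeq L₂) :
    ∃ L₃, IsReducedSeq L₃ ∧ syllableProd L₃ = syllableProd L₁ * syllableProd L₂ ∧
      |weightedSum φ L₁ f + weightedSum φ L₂ (fun u => f (syllableProd L₁ * u)) -
        weightedSum φ L₃ f| ≤ D * K := by
  have hK0 : 0 ≤ K := (abs_nonneg _).trans (hK 1)
  induction L₁ using List.reverseRecOn generalizing L₂ with
  | nil => exact ⟨L₂, h₂, by simp [syllableProd], by simp [weightedSum, syllableProd]; positivity⟩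
  | append_singleton A p ih =>
    cases L₂ with
    | nil =>
      exact ⟨A ++ [p], h₁, by simp [syllableProd], by simp [weightedSum]; positivity⟩
    | cons q B =>
      by_cases hpq : p.1 = q.1
      · obtain ⟨i, a⟩ := p
        obtain ⟨j, b⟩ := q
        obtain rfl : i = j := hpq
        have e1 : weightedSum φ (A ++ [⟨i, a⟩]) f =
            weightedSum φ A f + φ i a * f (syllableProd A) := by
          rw [weightedSum_append]; simp [weightedSum]
        -- The syllable `b` is weighted at the vertex after `a`; `hf` moves this vertex back across
        -- `a`.
        have e2 : weightedSum φ (⟨i, b⟩ :: B)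
            (fun u => f (syllableProd (A ++ [⟨i, a⟩]) * u)) = φ i b * f (syllableProd A) +
              weightedSum φ B fun u => f (syllableProd A * (of (a * b) * u)) := by
          simp [weightedSum, syllableProd, mul_assoc, hf]
        rw [e1, e2]
        by_cases hab : a * b = 1
        · obtain ⟨L₃, h3, hp, hle⟩ := ih B h₁.of_append.1 h₂.tail
          refine ⟨L₃, h3, ?_, ?_⟩
          · rw [hp]
            simp only [syllableProd, List.map_append, List.map_cons, List.map_nil, List.prod_append,
              List.prod_cons, List.prod_nil, mul_one, mul_assoc]
            rw [← mul_assoc (of a), ← _root_.map_mul, hab, _root_.map_one, one_mul]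
          -- With `b = a⁻¹` the two terms at the junction are opposite, so the bound for the shorter
          -- sequences carries over unchanged.
          · rw [eq_inv_of_mul_eq_one_right hab, hφ.map_inv, mul_inv_cancel]
            simp only [_root_.map_one, one_mul]
            convert hle using 2
            ring
        · refine ⟨_, h₁.merge h₂ hab, by simp [syllableProd, mul_assoc], ?_⟩
          rw [weightedSum_append]
          simp only [weightedSum, mul_one]
          rw [show weightedSum φ A f + φ i a * f (syllableProd A) + (φ i b * f (syllableProd A) +
            weightedSum φ B fun u => f (syllableProd A * (of (a * b) * u))) -
            (weightedSum φ A f + (φ i (a * b) * f (syllableProd A) +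
              weightedSum φ B fun u => f (syllableProd A * (of (a * b) * u)))) =
              (φ i a + φ i b - φ i (a * b)) * f (syllableProd A) by ring, abs_mul]
          exact mul_le_mul (hφ.defect_le i a b) (hK _) (abs_nonneg _) hD
      · refine ⟨_, h₁.append h₂ hpq, by simp [syllableProd, mul_assoc], ?_⟩
        rw [weightedSum_append φ (A ++ [p]), sub_self, abs_zero]
        positivity

open Classical in
/-- The sequence of syllables of an element of a free product. -/
noncomputable def syllables (g : CoprodI G) : List (Σ i, G i) := (Word.equiv g).toList

theorem syllables_isReducedSeq (g : CoprodI G) : IsReducedSeq (syllables g) := by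
  classical
  exact ⟨(Word.equiv g).ne_one, (List.isChain_map _).2 (Word.equiv g).chain_ne⟩

theorem syllableProd_syllables (g : CoprodI G) : syllableProd (syllables g) = g := by
  classical
  exact Word.equiv.symm_apply_apply g

theorem IsReducedSeq.syllables_eq {L : List (Σ i, G i)} (h : IsReducedSeq L) :
    syllables (syllableProd L) = L := by
  classical
  exact congrArg Word.toList
    (Word.equiv.apply_symm_apply (⟨L, h.1, (List.isChain_map _).1 h.2⟩ : Word G))

/-- The sum of `φᵢ(a) f(u)` over the syllables `a` of `g = u a u'`. -/
noncomputable def syllableSum (φ : ∀ i, G i → ℝ) (g : CoprodI G) (f : CoprodI G → ℝ) : ℝ :=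
  weightedSum φ (syllables g) f

theorem IsReducedSeq.syllableSum_eq {L : List (Σ i, G i)} (h : IsReducedSeq L)
    (φ : ∀ i, G i → ℝ) (f : CoprodI G → ℝ) :
    syllableSum φ (syllableProd L) f = weightedSum φ L f := by
  rw [syllableSum, h.syllables_eq]

theorem abs_syllableSum_defect_le {φ : ∀ i, G i → ℝ} {D K : ℝ} (hφ : IsAlternatingFamily φ D)
    (hD : 0 ≤ D) (f : CoprodI G → ℝ) (hK : ∀ u, |f u| ≤ K)
    (hf : ∀ i (a b : G i) u, φ i b * f (u * of a) = φ i b * f u) (g h : CoprodI G) :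
    |syllableSum φ g f + syllableSum φ h (fun u => f (g * u)) - syllableSum φ (g * h) f| ≤
      D * K := by
  obtain ⟨L, hL, hp, hle⟩ := exists_isReducedSeq_mul hφ hD f hK hf _ _
    (syllables_isReducedSeq g) (syllables_isReducedSeq h)
  rw [syllableProd_syllables, syllableProd_syllables] at hp
  rw [syllableProd_syllables] at hle
  rwa [← hp, hL.syllableSum_eq]

/-! ### Split quasimorphisms -/

/-- The quasimorphism `∑ φᵢ(a)`, the sum being over all syllables. -/
noncomputable def splitMap (φ : ∀ i, G i → ℝ) (g : CoprodI G) : ℝ := syllableSum φ g fun _ => 1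

theorem abs_splitMap_defect_le {φ : ∀ i, G i → ℝ} {D : ℝ} (hφ : IsAlternatingFamily φ D)
    (hD : 0 ≤ D) (g h : CoprodI G) :
    |splitMap φ g + splitMap φ h - splitMap φ (g * h)| ≤ D := by
  simpa [splitMap] using abs_syllableSum_defect_le hφ hD (fun _ => 1) (K := 1) (by simp) (by simp) g h

theorem splitMap_comp_mem {φ : ∀ i, G i → ℝ} {D : ℝ} (hφ : IsAlternatingFamily φ D) (hD : 0 ≤ D)
    {H : Type*} [Group H] (θ : H →* CoprodI G) :
    (fun x => splitMap φ (θ x)) ∈ BoundedCohomology.Quasimorphisms H :=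
  ⟨D, fun g h => by
    simpa only [_root_.map_mul] using abs_splitMap_defect_le hφ hD (θ g) (θ h)⟩

theorem weightedSum_one (φ : ∀ i, G i → ℝ) (L : List (Σ i, G i)) :
    weightedSum φ L (fun _ => 1) = (L.map fun p => φ p.1 p.2).sum := by
  induction L with
  | nil => rfl
  | cons p L ih => simp [weightedSum, ih]

/-- `splitMap φ` does not see left factors from a group on which `φ` vanishes. -/
theorem splitMap_of_mul {φ : ∀ i, G i → ℝ} {i : ι} (hi : ∀ a, φ i a = 0) (a : G i)
    (g : CoprodI G) : splitMap φ (of a * g) = splitMap φ g := by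
  by_cases ha : a = 1
  · simp [ha]
  have hs : IsReducedSeq ([] ++ [(⟨i, a⟩ : Σ i, G i)]) := ⟨by simp [ha], by simp⟩
  -- Left multiplication by `a` can only create, alter or delete a first syllable in the factor `i`,
  -- where `φ` is zero.
  have key : ∀ L, IsReducedSeq L →
      splitMap φ (of a * syllableProd L) = splitMap φ (syllableProd L) := by
    intro L hL
    rw [splitMap, splitMap, hL.syllableSum_eq, weightedSum_one]
    cases L with
    | nil =>
      have : (of a * syllableProd ([] : List (Σ i, G i))) = syllableProd ([] ++ [⟨i, a⟩]) := by
        simp [syllableProd]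
      rw [this, hs.syllableSum_eq, weightedSum_one]
      simp [hi]
    | cons q B =>
      by_cases hq : i = q.1
      · obtain ⟨j, b⟩ := q
        obtain rfl : i = j := hq
        by_cases hab : a * b = 1
        · have : of a * syllableProd (⟨i, b⟩ :: B) = syllableProd B := by
            simp only [syllableProd, List.map_cons, List.prod_cons]
            rw [← mul_assoc, ← _root_.map_mul, hab, _root_.map_one, one_mul]
          rw [this, hL.tail.syllableSum_eq, weightedSum_one]
          simp [hi]
        · have : of a * syllableProd (⟨i, b⟩ :: B) = syllableProd ([] ++ ⟨i, a * b⟩ :: B) := by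
            simp [syllableProd, mul_assoc]
          rw [this, (hs.merge hL hab).syllableSum_eq, weightedSum_one]
          simp [hi]
      · have : of a * syllableProd (q :: B) = syllableProd ([] ++ [⟨i, a⟩] ++ q :: B) := by
          simp [syllableProd]
        rw [this, (hs.append hL hq).syllableSum_eq, weightedSum_one]
        simp [hi]
  simpa [syllableProd_syllables] using key _ (syllables_isReducedSeq g)

end FreeProduct

/-! ### Vanishing cup products at the cochain level; alternating representatives -/

namespace BoundedCohomology

variable {G : Type*} [Group G]

/-- `dφ ⌣ dψ` is the coboundary of a bounded cochain. -/
def CupDefectTrivial (φ ψ : G → ℝ) : Prop :=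
  ∃ β : G → G → G → ℝ, (∃ C, ∀ a b c, |β a b c| ≤ C) ∧ ∀ a b c d,
    β b c d - β (a * b) c d + β a (b * c) d - β a b (c * d) + β a b c =
      (φ a + φ b - φ (a * b)) * (ψ c + ψ d - ψ (c * d))

theorem CupDefectTrivial.comp {H : Type*} [Group H] {φ ψ : G → ℝ} (h : CupDefectTrivial φ ψ)
    (θ : H →* G) : CupDefectTrivial (fun x => φ (θ x)) fun x => ψ (θ x) := by
  obtain ⟨β, ⟨C, hC⟩, h⟩ := h
  exact ⟨fun a b c => β (θ a) (θ b) (θ c), ⟨C, fun a b c => hC _ _ _⟩, fun a b c d => by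
    simpa only [map_mul] using h (θ a) (θ b) (θ c) (θ d)⟩

theorem CupDefectTrivial.cup_eq_zero {φ ψ : Quasimorphisms G} (h : CupDefectTrivial φ.1 ψ.1) :
    cup (deltaClass φ) (deltaClass ψ) = 0 := by
  obtain ⟨β, ⟨C, hC⟩, h⟩ := h
  rw [deltaClass, deltaClass, cup_mk]
  refine (Submodule.Quotient.mk_eq_zero _).2 ?_
  change _ ∈ (boundedCochains G 3).map (coboundary G 3)
  refine ⟨fun x => β (x 0) (x 1) (x 2), ⟨C, fun x => hC _ _ _⟩, ?_⟩
  funext x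
  change _ = coboundary G 1 (fun y => φ.1 (y 0)) _ * coboundary G 1 (fun y => ψ.1 (y 0)) _
  rw [coboundary_one, coboundary_one, coboundary_apply, Fin.sum_univ_four]
  simp only [Fin.contractNth]
  refine Eq.trans ?_ (h (x 0) (x 1) (x 2) (x 3))
  simp [Fin.succ]
  ring

theorem deltaClass_eq_of_bounded {φ ψ : Quasimorphisms G} {C : ℝ}
    (h : ∀ g, |φ.1 g - ψ.1 g| ≤ C) : deltaClass φ = deltaClass ψ := by
  refine (Submodule.Quotient.eq _).2 ?_
  change _ ∈ (boundedCochains G 1).map (coboundary G 1)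
  refine ⟨fun x => φ.1 (x 0) - ψ.1 (x 0), ⟨C, fun x => h _⟩, ?_⟩
  change _ = coboundary G 1 (fun x => φ.1 (x 0)) - coboundary G 1 (fun x => ψ.1 (x 0))
  rw [← map_sub]
  rfl

/-- Every quasimorphism is at bounded distance from an alternating one. -/
theorem exists_alternating_quasimorphism (φ : Quasimorphisms G) :
    ∃ φ' : Quasimorphisms G, (∀ g, φ'.1 g⁻¹ = -φ'.1 g) ∧ deltaClass φ = deltaClass φ' := by
  obtain ⟨D, hD⟩ := φ.2
  refine ⟨⟨fun g => (φ.1 g - φ.1 g⁻¹) / 2, D, fun g h => ?_⟩, fun g => ?_,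
    deltaClass_eq_of_bounded (C := D + |φ.1 1|) fun g => ?_⟩
  · have h1 := abs_le.1 (hD g h)
    have h2 := abs_le.1 (hD h⁻¹ g⁻¹)
    simp only [mul_inv_rev]
    rw [abs_le]
    constructor <;> linarith
  · simp only [inv_inv]
    ring
  · have h1 := abs_le.1 (hD g g⁻¹)
    have h0 := (abs_nonneg _).trans (hD 1 1)
    rw [mul_inv_cancel] at h1
    have h2 := neg_abs_le (φ.1 1)
    have h3 := le_abs_self (φ.1 1)
    simp only
    rw [abs_le]
    constructor <;> linarith

end BoundedCohomology

/-! ### An explicit bounded primitive on a free product -/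

namespace FreeProduct

open Monoid Monoid.CoprodI BoundedCohomology

section

variable {ι : Type*} {G : ι → Type*} [∀ i, Group (G i)]

theorem syllableSum_linear (φ : ∀ i, G i → ℝ) (g : CoprodI G) (c : ℝ)
    (f f' : CoprodI G → ℝ) :
    syllableSum φ g (fun u => f u + c * f' u) = syllableSum φ g f + c * syllableSum φ g f' :=
  weightedSum_linear φ _ c f f'

/-- The defect of `ψ` on the triangle with vertices `u`, `z`, `t`. -/
def triangleDefect {H : Type*} [Group H] (ψ : H → ℝ) (z t u : H) : ℝ :=
  ψ (u⁻¹ * z) + ψ (z⁻¹ * t) - ψ (u⁻¹ * t)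

theorem triangleDefect_mul_left {H : Type*} [Group H] (ψ : H → ℝ) (g z t u : H) :
    triangleDefect ψ (g * z) (g * t) (g * u) = triangleDefect ψ z t u := by
  simp [triangleDefect, mul_assoc]

/-- By the cocycle identity on the tetrahedron `u, y, z, t`, the three faces containing `u` add up,
with signs, to the face `y, z, t`. This is constant in `u` and leaves the sum over the syllables. -/
theorem syllableSum_triangleDefect (φ : ∀ i, G i → ℝ) (ψ : CoprodI G → ℝ) (g y z t : CoprodI G) :
    syllableSum φ g (triangleDefect ψ z t) - syllableSum φ g (triangleDefect ψ y t) +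
      syllableSum φ g (triangleDefect ψ y z) =
        splitMap φ g * (ψ (y⁻¹ * z) + ψ (z⁻¹ * t) - ψ (y⁻¹ * t)) := by
  have h1 := syllableSum_linear φ g (-1) (triangleDefect ψ z t) (triangleDefect ψ y t)
  have h2 := syllableSum_linear φ g 1
    (fun u => triangleDefect ψ z t u + -1 * triangleDefect ψ y t u) (triangleDefect ψ y z)
  have h3 := syllableSum_linear φ g (ψ (y⁻¹ * z) + ψ (z⁻¹ * t) - ψ (y⁻¹ * t)) (fun _ => 0)
    (fun _ => 1)
  have h4 : syllableSum φ g (fun _ => 0) = 0 := by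
    have := syllableSum_linear φ g (-1) (fun _ => 0) (fun _ => 0)
    simp only [mul_zero, add_zero] at this
    linarith
  have h5 : (fun u => triangleDefect ψ z t u + -1 * triangleDefect ψ y t u +
      1 * triangleDefect ψ y z u) =
      fun _ => 0 + (ψ (y⁻¹ * z) + ψ (z⁻¹ * t) - ψ (y⁻¹ * t)) * 1 := by
    funext u
    simp only [triangleDefect]
    ring
  rw [h5, h3, h4, h1] at h2
  rw [splitMap]
  linarith

/-- The classes of two split quasimorphisms that live on distinct factors of a free product have
trivial cup product. -/
theorem cupDefectTrivial_splitMap {φ ψ : ∀ i, G i → ℝ} {D D' : ℝ}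
    (hφ : IsAlternatingFamily φ D) (hD : 0 ≤ D) (hψ : IsAlternatingFamily ψ D') (hD' : 0 ≤ D')
    (hφψ : ∀ i, (∀ a, φ i a = 0) ∨ ∀ a, ψ i a = 0) :
    CupDefectTrivial (splitMap φ) (splitMap ψ) := by
  set M : CoprodI G → CoprodI G → CoprodI G → ℝ :=
    fun g z t => syllableSum φ g (triangleDefect (splitMap ψ) z t) with hM
  have key : ∀ g y z t, M g z t - M g y t + M g y z = splitMap φ g *
      (splitMap ψ (y⁻¹ * z) + splitMap ψ (z⁻¹ * t) - splitMap ψ (y⁻¹ * t)) :=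
    syllableSum_triangleDefect φ _
  -- The primitive is the defect of `g ↦ M g (a * b) (a * b * c)` at the pair `a, b`; the middle
  -- term is its translate by `a⁻¹`.
  refine ⟨fun a b c => M a (a * b) (a * b * c) + M b b (b * c) - M (a * b) (a * b) (a * b * c),
    ⟨D * D', fun a b c => ?_⟩, fun a b c d => ?_⟩
  · have hK : ∀ z t u, |triangleDefect (splitMap ψ) z t u| ≤ D' := by
      intro z t u
      have := abs_splitMap_defect_le hψ hD' (u⁻¹ * z) (z⁻¹ * t)
      rwa [show u⁻¹ * z * (z⁻¹ * t) = u⁻¹ * t by group] at this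
    have hinv : ∀ z t i (a b : G i) u, φ i b * triangleDefect (splitMap ψ) z t (u * of a) =
        φ i b * triangleDefect (splitMap ψ) z t u := by
      intro z t i a b u
      rcases hφψ i with h | h
      · simp [h]
      -- Only factors on which `φ` may be nonzero matter; there `ψ` vanishes, so the left factor
      -- `a⁻¹` of `(u a)⁻¹ x` is invisible.
      · have : ∀ x, splitMap ψ ((u * of a)⁻¹ * x) = splitMap ψ (u⁻¹ * x) := fun x => by
          rw [mul_inv_rev, mul_assoc, ← _root_.map_inv, splitMap_of_mul h]
        simp only [triangleDefect, this]
    have := abs_syllableSum_defect_le hφ hD (triangleDefect (splitMap ψ) (a * b) (a * b * c))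
      (hK _ _) (hinv _ _) a b
    simp only [hM, mul_assoc] at this ⊢
    simpa only [triangleDefect_mul_left] using this
  -- All three relations have the same right-hand factor, the defect of `splitMap ψ` at `c, d`;
  -- their coefficients combine to the defect of `splitMap φ` at `a, b`.
  · have h1 := key a (a * b) (a * b * c) (a * b * c * d)
    have h2 := key b b (b * c) (b * c * d)
    have h3 := key (a * b) (a * b) (a * b * c) (a * b * c * d)
    simp only [show ∀ x y : CoprodI G, x⁻¹ * (x * y) = y from inv_mul_cancel_left,
      mul_assoc, mul_inv_rev] at h1 h2 h3 ⊢
    linear_combination h1 + h2 - h3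

end

end FreeProduct

/-! ### Reduction to split quasimorphisms along `ι` -/

namespace BoundedCohomology

open Monoid FreeProduct

/-- Every pair of classes on `G` is pulled back along `ι` from split quasimorphisms on different
factors, whose cup product already vanishes. -/
theorem cup_eq_zero_of_coprod {G : Type*} [Group G]
    (hQ : ∀ φ ψ : Quasimorphisms (Coprod G G), cup (deltaClass φ) (deltaClass ψ) = 0 →
      cup (deltaClass (compIota φ)) (deltaClass (compIota ψ)) = 0) (φ ψ : Quasimorphisms G) :
    cup (deltaClass φ) (deltaClass ψ) = 0 := by
  obtain ⟨φ', hφ', eφ⟩ := exists_alternating_quasimorphism φ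
  obtain ⟨ψ', hψ', eψ⟩ := exists_alternating_quasimorphism ψ
  rw [eφ, eψ]
  have family : ∀ (χ : Quasimorphisms G), (∀ g, χ.1 g⁻¹ = -χ.1 g) → ∀ i : Bool, ∃ D : ℝ, 0 ≤ D ∧
      IsAlternatingFamily (G := fun _ : Bool => G) (fun j g => if j = i then χ.1 g else 0) D := by
    intro χ hχ i
    obtain ⟨D, hD⟩ := χ.2
    have h0 : 0 ≤ D := (abs_nonneg _).trans (hD 1 1)
    refine ⟨D, h0, fun j g => ?_, fun j g h => ?_⟩
    · by_cases hj : j = i <;> simp [hj, hχ]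
    · by_cases hj : j = i <;> simp [hj, hD, h0]
  let θ : Coprod G G →* CoprodI fun _ : Bool => G :=
    Coprod.lift (CoprodI.of (M := fun _ : Bool => G) (i := true))
      (CoprodI.of (M := fun _ : Bool => G) (i := false))
  obtain ⟨D, hD, hΦ⟩ := family φ' hφ' true
  obtain ⟨D', hD', hΨ⟩ := family ψ' hψ' false
  let Φ : Quasimorphisms (Coprod G G) := ⟨_, splitMap_comp_mem hΦ hD θ⟩
  let Ψ : Quasimorphisms (Coprod G G) := ⟨_, splitMap_comp_mem hΨ hD' θ⟩
  have key : ∀ (χ : Quasimorphisms G) (i : Bool), χ.1 1 = 0 → ∀ g,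
      splitMap (G := fun _ : Bool => G) (fun j g => if j = i then χ.1 g else 0)
        (θ (iota G g)) = χ.1 g := by
    intro χ i h1 g
    have hθ : θ (iota G g) =
        syllableProd (G := fun _ : Bool => G) [⟨true, g⟩, ⟨false, g⟩] := by
      simp [θ, iota, syllableProd]
    -- For `g = 1` the two-syllable sequence is not reduced; alternation, which gives `χ 1 = 0`,
    -- covers this case.
    by_cases hg : g = 1
    · have : θ (iota G g) = syllableProd [] := by simp [iota, syllableProd, hg]
      rw [this, splitMap, IsReducedSeq.nil.syllableSum_eq, weightedSum_one, hg, h1]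
      simp
    · have : IsReducedSeq (G := fun _ : Bool => G) [⟨true, g⟩, ⟨false, g⟩] :=
        ⟨by simp [hg], by simp⟩
      rw [hθ, splitMap, this.syllableSum_eq, weightedSum_one]
      cases i <;> simp
  have map_one : ∀ χ : Quasimorphisms G, (∀ g, χ.1 g⁻¹ = -χ.1 g) → χ.1 1 = 0 := by
    intro χ hχ
    have := hχ 1
    rw [inv_one] at this
    linarith
  have eΦ : compIota Φ = φ' := Subtype.ext (funext fun g => key φ' true (map_one _ hφ') g)
  have eΨ : compIota Ψ = ψ' := Subtype.ext (funext fun g => key ψ' false (map_one _ hψ') g)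
  have := hQ Φ Ψ (((cupDefectTrivial_splitMap hΦ hD hΨ hD' fun i => by
    cases i <;> simp).comp θ).cup_eq_zero)
  rwa [eΦ, eΨ] at this

end BoundedCohomology

namespace FreeDecomposition

open BoundedCohomology

/-! ### Rolli quasimorphisms -/

section Rolli

open Monoid FreeProduct

/-- Viewed in the free product of the infinite cyclic groups generated by the basis, the powers `s ^
m` are the syllables and a Rolli map is a split map. Finiteness of `S` gives the bounded functions a
common bound, hence a common defect. -/
theorem IsRolli.mem_quasimorphisms {S : Type*} [Finite S] {φ : FreeGroup S → ℝ}
    (hφ : IsRolli φ) : φ ∈ Quasimorphisms (FreeGroup S) := by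
  obtain ⟨lam, hb, hinv, hsum⟩ := hφ
  choose C hC using hb
  obtain ⟨K, hK⟩ := Set.finite_range C |>.bddAbove
  have hK' : ∀ s m, |lam s m| ≤ max K 0 := fun s m =>
    (hC s m).trans ((hK ⟨s, rfl⟩).trans (le_max_left _ _))
  have hfam : IsAlternatingFamily (G := fun _ : S => Multiplicative ℤ)
      (fun s a => lam s a.toAdd) (3 * max K 0) := by
    refine ⟨fun s a => hinv s _, fun s a b => ?_⟩
    have h1 := abs_le.1 (hK' s a.toAdd)
    have h2 := abs_le.1 (hK' s b.toAdd)
    have h3 := abs_le.1 (hK' s (a * b).toAdd)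
    rw [abs_le]
    constructor <;> linarith
  let θ : FreeGroup S →* CoprodI fun _ : S => Multiplicative ℤ :=
    FreeGroup.lift fun s => CoprodI.of (i := s) (M := fun _ : S => Multiplicative ℤ)
      (Multiplicative.ofAdd 1)
  let θ' : (CoprodI fun _ : S => Multiplicative ℤ) →* FreeGroup S :=
    CoprodI.lift fun s => zpowersHom _ (FreeGroup.of s)
  have hθ : ∀ g, θ' (θ g) = g := fun g => DFunLike.congr_fun
    (show θ'.comp θ = MonoidHom.id _ from FreeGroup.ext_hom _ _ fun s => by simp [θ, θ']) g
  convert splitMap_comp_mem hfam (by positivity) θ with g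
  have hr := syllables_isReducedSeq (θ g)
  have := hsum ((syllables (θ g)).map fun p => (p.1, p.2.toAdd))
    (by
      intro p hp
      obtain ⟨q, hq, rfl⟩ := List.mem_map.1 hp
      exact fun h => hr.1 q hq (Multiplicative.toAdd.injective h))
    ((List.isChain_map _).2 ((List.isChain_map _).1 hr.2))
  rw [List.map_map, List.map_map] at this
  rw [splitMap, syllableSum, weightedSum_one]
  refine Eq.trans ?_ this
  congr 1
  conv_lhs => rw [← hθ g, ← syllableProd_syllables (θ g), syllableProd, map_list_prod, List.map_map]
  congr 2

end Rolli

/-! ### `Δ`-triangles and decomposable maps -/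

section Triangles

variable {X : Type*} [DecidableEq X]

theorem commonPrefix_prefix (l m : List X) :
    commonPrefix l m <+: l ∧ commonPrefix l m <+: m := by
  induction l generalizing m with
  | nil => simp [commonPrefix]
  | cons a l ih =>
    cases m with
    | nil => simp [commonPrefix]
    | cons b m =>
      by_cases h : a = b
      · simpa [commonPrefix, h] using ih m
      · simp [commonPrefix, h]

theorem commonSuffix_suffix (l m : List X) :
    commonSuffix l m <:+ l ∧ commonSuffix l m <:+ m := by
  have := commonPrefix_prefix l.reverse m.reverse
  exact ⟨by simpa [commonSuffix] using List.reverse_suffix.2 this.1,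
    by simpa [commonSuffix] using List.reverse_suffix.2 this.2⟩

end Triangles

theorem append_rdrop_drop_append {X : Type*} {l P Q : List X} (hP : P <+: l) (hQ : Q <:+ l)
    (h : P.length + Q.length ≤ l.length) :
    l = P ++ (l.drop P.length).rdrop Q.length ++ Q := by
  obtain ⟨m, rfl⟩ := hP
  have hQm : Q <:+ m :=
    List.suffix_of_suffix_length_le hQ (List.suffix_append _ _) (by simp at h; omega)
  obtain ⟨r, rfl⟩ := hQm
  simp [List.rdrop]

section InvSeq

variable {G : Type*} [Group G]

theorem invSeq_append (l m : List G) : invSeq (l ++ m) = invSeq m ++ invSeq l := by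
  simp [invSeq]

theorem invSeq_length (l : List G) : (invSeq l).length = l.length := by
  simp [invSeq]

theorem invSeq_prefix_invSeq {l m : List G} (h : l <:+ m) : invSeq l <+: invSeq m := by
  obtain ⟨r, rfl⟩ := h
  exact ⟨invSeq r, (invSeq_append _ _).symm⟩

theorem sum_map_invSeq {f : G → ℝ} {l : List G} (h : ∀ p ∈ l, f p⁻¹ = -f p) :
    ((invSeq l).map f).sum = -(l.map f).sum := by
  induction l with
  | nil => simp [invSeq]
  | cons p l ih =>
    have : invSeq (p :: l) = invSeq l ++ [p⁻¹] := by simp [invSeq]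
    rw [this, List.map_append, List.sum_append, ih fun q hq => h q (by simp [hq])]
    simp [h p (by simp)]

end InvSeq

theorem abs_sum_map_le {X : Type*} {f : X → ℝ} {l : List X} {C : ℝ} (h : ∀ p ∈ l, |f p| ≤ C) :
    |(l.map f).sum| ≤ l.length * C := by
  induction l with
  | nil => simp
  | cons p l ih =>
    have h1 := ih fun q hq => h q (by simp [hq])
    have h2 := h p (by simp)
    simp only [List.map_cons, List.sum_cons, List.length_cons, Nat.cast_add, Nat.cast_one]
    refine (abs_add_le _ _).trans ?_
    linarith

section Decomposable

variable {S : Type*} [DecidableEq S] (Δ : Decomposition S)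

/-- Such an infix would have product `1`, whose sequence is empty, against infix closedness. -/
theorem Decomposition.seq_ne_append_inv_cons (g p : FreeGroup S) (l m : List (FreeGroup S)) :
    Δ.seq g ≠ l ++ p⁻¹ :: p :: m := by
  intro h
  have := Δ.seq_infix g [p⁻¹, p] ⟨l, m, by simp [h]⟩
  simp [Δ.seq_one] at this

/-- In a `Δ`-triangle, the two parts that a side shares with the other sides do not intersect. -/
theorem Decomposition.length_add_length_le {x y : FreeGroup S} {P Q : List (FreeGroup S)}
    (hP : P <+: Δ.seq x) (hP' : P <+: Δ.seq (x * y)) (hQ : Q <:+ Δ.seq x)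
    (hQ' : Q <:+ Δ.seq y⁻¹) : P.length + Q.length ≤ (Δ.seq x).length := by
  by_contra! hlt
  rcases List.eq_nil_or_concat P with rfl | ⟨X, p, rfl⟩
  · have := hQ.length_le
    simp at hlt
    omega
  rw [List.concat_eq_append] at *
  obtain ⟨Y, hY⟩ := hP
  obtain ⟨Z, hZ⟩ := hP'
  -- If the parts met, the last piece `p` of `P` would also lie in `Q`, hence be common to all three
  -- sides.
  have hpY : p :: Y <:+ Q := by
    refine List.suffix_of_suffix_length_le ⟨X, ?_⟩ hQ ?_
    · rw [← hY]; simp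
    · rw [← hY] at hlt; simp at hlt ⊢; omega
  obtain ⟨W, hW⟩ := hpY.trans hQ'
  have hx : x = X.prod * p * Y.prod := by
    rw [← Δ.prod_seq x, ← hY]; simp [mul_assoc]
  have hy : y⁻¹ = W.prod * p * Y.prod := by
    rw [← Δ.prod_seq y⁻¹, ← hW]; simp [mul_assoc]
  have hxy : x * y = X.prod * p * Z.prod := by
    rw [← Δ.prod_seq (x * y), ← hZ]; simp [mul_assoc]
  have hWZ : W.prod⁻¹ = (p :: Z).prod := by
    rw [← inv_inv y, hy, hx] at hxy
    rw [List.prod_cons]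
    refine mul_left_cancel (a := X.prod) ?_
    rw [← mul_assoc, ← hxy]
    group
  have h1 : Δ.seq W.prod = W := Δ.seq_infix y⁻¹ W ⟨[], p :: Y, by simpa using hW⟩
  have h2 : Δ.seq (p :: Z).prod = p :: Z := Δ.seq_infix (x * y) _ ⟨X, [], by simpa using hZ⟩
  have h3 : invSeq W = p :: Z := by rw [← h2, ← hWZ, Δ.seq_inv, h1]
  -- Inverting `W, p, Y` and using `h3` shows `p⁻¹, p` as consecutive pieces of `y`.
  refine Δ.seq_ne_append_inv_cons y p (invSeq Y) Z ?_
  rw [← inv_inv y, Δ.seq_inv, ← hW, ← h3]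
  simp [invSeq]

/-- Each `c`-part occurs on two sides and its contributions cancel, for `c₂` by alternation. What
remains are three `r`-parts of at most `D` pieces each. -/
theorem Decomposition.IsDecomposable.mem_quasimorphisms {Δ : Decomposition S}
    {φ : FreeGroup S → ℝ} (hφ : Δ.IsDecomposable φ) : φ ∈ Quasimorphisms (FreeGroup S) := by
  obtain ⟨lam, ⟨C, hC⟩, hinv, hsum⟩ := hφ
  obtain ⟨D, hD⟩ := Δ.defect_finite
  refine ⟨3 * (D * max C 0), fun g h => ?_⟩
  obtain ⟨hr1, hr2, hr3⟩ := hD g h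
  obtain ⟨p1, p1'⟩ := commonPrefix_prefix (Δ.seq g) (Δ.seq (g * h))
  obtain ⟨p2, p2'⟩ := commonSuffix_suffix (Δ.seq g) (Δ.seq h⁻¹)
  obtain ⟨p3, p3'⟩ := commonSuffix_suffix (Δ.seq h) (Δ.seq (g * h))
  have q2 : invSeq (c₂ Δ.seq g h) <+: Δ.seq g⁻¹ := by
    rw [Δ.seq_inv]; exact invSeq_prefix_invSeq p2
  have q2' : invSeq (c₂ Δ.seq g h) <+: Δ.seq h := by
    rw [← inv_inv h, Δ.seq_inv, inv_inv]; exact invSeq_prefix_invSeq p2'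
  -- Non-intersection of the common parts is needed on all three sides; the last two follow by
  -- applying the lemma to the rotated or reflected triangle.
  have e1 := append_rdrop_drop_append p1 p2 (Δ.length_add_length_le p1 p1' p2 p2')
  have e2 := append_rdrop_drop_append q2' p3 (Δ.length_add_length_le (y := (g * h)⁻¹) q2'
    (by simpa using q2) p3 (by simpa using p3'))
  have e3 := append_rdrop_drop_append p1' p3' (Δ.length_add_length_le (y := h⁻¹) p1'
    (by simpa using p1) p3' (by simpa using p3))
  change Δ.seq g = c₁Inv Δ.seq g h ++ r₁ Δ.seq g h ++ c₂ Δ.seq g h at e1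
  rw [invSeq_length] at e2
  change Δ.seq h = invSeq (c₂ Δ.seq g h) ++ r₂ Δ.seq g h ++ c₃ Δ.seq g h at e2
  change Δ.seq (g * h) = c₁Inv Δ.seq g h ++
    ((Δ.seq (g * h)).drop (c₁Inv Δ.seq g h).length).rdrop (c₃ Δ.seq g h).length ++
      c₃ Δ.seq g h at e3
  rw [r₃, invSeq_length] at hr3
  set m := ((Δ.seq (g * h)).drop (c₁Inv Δ.seq g h).length).rdrop (c₃ Δ.seq g h).length
  have bound : ∀ x, ∀ l : List (FreeGroup S), (∀ p ∈ l, p ∈ Δ.seq x) → l.length ≤ D →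
      |(l.map lam).sum| ≤ D * max C 0 := by
    intro x l hl hlen
    refine (abs_sum_map_le (C := max C 0) fun p hp =>
      (hC p (Δ.seq_mem x p (hl p hp))).trans (le_max_left _ _)).trans ?_
    gcongr
  have b1 := abs_le.1 (bound g (r₁ Δ.seq g h) (fun p hp => by rw [e1]; simp [hp]) hr1)
  have b2 := abs_le.1 (bound h (r₂ Δ.seq g h) (fun p hp => by rw [e2]; simp [hp]) hr2)
  have b3 := abs_le.1 (bound (g * h) m (fun p hp => by rw [e3]; simp [hp]) hr3)
  have hc := sum_map_invSeq (f := lam) (l := c₂ Δ.seq g h)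
    fun p hp => hinv p (Δ.seq_mem g p (by rw [e1]; simp [hp]))
  rw [hsum, hsum, hsum, e1, e2, e3]
  simp only [List.map_append, List.sum_append, hc]
  rw [abs_le]
  constructor <;> linarith

end Decomposable

end FreeDecomposition

/-! ### Cancellation in free groups and small counting functions -/

namespace FreeDecomposition

open BoundedCohomology FreeGroup

variable {S : Type*} [DecidableEq S]

theorem exists_reduced_cancellation {L₁ L₂ : List (S × Bool)} (h₁ : IsReduced L₁)
    (h₂ : IsReduced L₂) :
    ∃ A B C, L₁ = A ++ B ∧ L₂ = invRev B ++ C ∧ IsReduced (A ++ C) := by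
  induction L₁ using List.reverseRecOn generalizing L₂ with
  | nil => exact ⟨[], [], L₂, rfl, rfl, h₂⟩
  | append_singleton A p ih =>
    cases L₂ with
    | nil => exact ⟨A ++ [p], [], [], by simp, by simp [invRev], by simpa using h₁⟩
    | cons q M =>
      by_cases hpq : p.1 = q.1 → p.2 = q.2
      · exact ⟨A ++ [p], [], q :: M, by simp, by simp [invRev], by
          rw [List.append_assoc]
          exact List.isChain_append_cons_cons.2 ⟨h₁, hpq, h₂⟩⟩
      · obtain ⟨A', B, C, rfl, rfl, h⟩ := ih (h₁.infix (List.prefix_append _ _).isInfix)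
          (h₂.infix (List.suffix_cons q M).isInfix)
        refine ⟨A', B ++ [p], C, by simp, ?_, h⟩
        push Not at hpq
        have : q = (p.1, !p.2) := by
          refine Prod.ext hpq.1.symm ?_
          have := hpq.2
          revert this
          cases p.2 <;> cases q.2 <;> simp
        simp [invRev, this]

/-- Any product of two elements of a free group is obtained by cancelling `b` in
`(a b) (b⁻¹ c)`. -/
theorem exists_cancellation (g h : FreeGroup S) : ∃ a b c : FreeGroup S,
    g = a * b ∧ h = b⁻¹ * c ∧ (a * b).toWord = a.toWord ++ b.toWord ∧
      (b⁻¹ * c).toWord = b⁻¹.toWord ++ c.toWord ∧ (a * c).toWord = a.toWord ++ c.toWord := by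
  obtain ⟨A, B, C, h1, h2, h3⟩ :=
    exists_reduced_cancellation (isReduced_toWord (x := g)) (isReduced_toWord (x := h))
  have r1 : IsReduced (A ++ B) := h1 ▸ isReduced_toWord
  have r2 : IsReduced (invRev B ++ C) := h2 ▸ isReduced_toWord
  have rA := (r1.infix (List.prefix_append _ _).isInfix).reduce_eq
  have rB := (r1.infix (List.suffix_append _ _).isInfix).reduce_eq
  have rB' := (r2.infix (List.prefix_append _ _).isInfix).reduce_eq
  have rC := (r2.infix (List.suffix_append _ _).isInfix).reduce_eq
  refine ⟨mk A, mk B, mk C, ?_, ?_, ?_, ?_, ?_⟩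
  · rw [← mk_toWord (x := g), h1, mul_mk]
  · rw [← mk_toWord (x := h), h2, inv_mk, mul_mk]
  · rw [mul_mk, toWord_mk, toWord_mk, toWord_mk, rA, rB, r1.reduce_eq]
  · rw [inv_mk, mul_mk, toWord_mk, toWord_mk, toWord_mk, rC, rB', r2.reduce_eq]
  · rw [mul_mk, toWord_mk, toWord_mk, toWord_mk, rA, rC, h3.reduce_eq]

/-- An alternating map that is almost additive on reduced products is a quasimorphism. -/
theorem mem_quasimorphisms_of_reduced {f : FreeGroup S → ℝ} (hinv : ∀ g, f g⁻¹ = -f g) (C : ℝ)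
    (hf : ∀ g h : FreeGroup S, (g * h).toWord = g.toWord ++ h.toWord →
      |f g + f h - f (g * h)| ≤ C) : f ∈ Quasimorphisms (FreeGroup S) := by
  refine ⟨3 * C, fun g h => ?_⟩
  obtain ⟨a, b, c, rfl, rfl, h1, h2, h3⟩ := exists_cancellation g h
  have e1 := abs_le.1 (hf _ _ h1)
  have e2 := abs_le.1 (hf _ _ h2)
  have e3 := abs_le.1 (hf _ _ h3)
  -- Alternation lets the contributions of the cancelled part `b` in `e1` and `e2` cancel.
  rw [hinv] at e2
  rw [show a * b * (b⁻¹ * c) = a * c by group, abs_le]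
  constructor <;> linarith

theorem occursAt_iff {w g : FreeGroup S} {i : ℕ} :
    OccursAt w g i ↔ i + w.norm ≤ g.norm ∧ (g.toWord.drop i).take w.norm = w.toWord := by
  constructor
  · rintro ⟨u, v, rfl, h⟩
    simp [FreeGroup.norm, h]
  · rintro ⟨h1, h2⟩
    simp only [FreeGroup.norm] at h1 h2
    refine ⟨g.toWord.take i, g.toWord.drop (i + w.toWord.length), by simp; omega, ?_⟩
    rw [← List.drop_drop]
    conv_rhs => enter [1, 2]; rw [← h2]
    rw [List.append_assoc, List.take_append_drop, List.take_append_drop]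

theorem OccursAt.inv {w g : FreeGroup S} {i : ℕ} (h : OccursAt w g i) :
    OccursAt w⁻¹ g⁻¹ (g.norm - (i + w.norm)) := by
  obtain ⟨u, v, rfl, h⟩ := h
  refine ⟨invRev v, invRev u, ?_, ?_⟩
  · simp [FreeGroup.norm, h, invRev]
    omega
  · rw [toWord_inv, toWord_inv, h]
    simp [invRev]

theorem occursAt_mul_left {w g h : FreeGroup S} (hgh : (g * h).toWord = g.toWord ++ h.toWord)
    {i : ℕ} (hi : i + w.norm ≤ g.norm) : OccursAt w (g * h) i ↔ OccursAt w g i := by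
  rw [occursAt_iff, occursAt_iff, hgh]
  simp only [FreeGroup.norm] at *
  rw [hgh, List.length_append, List.drop_append_of_le_length (by omega),
    List.take_append_of_le_length (by simp; omega)]
  exact and_congr_left fun _ => ⟨fun _ => hi, fun _ => by omega⟩

theorem occursAt_mul_right {w g h : FreeGroup S} (hgh : (g * h).toWord = g.toWord ++ h.toWord)
    {i : ℕ} : OccursAt w (g * h) (g.norm + i) ↔ OccursAt w h i := by
  rw [occursAt_iff, occursAt_iff, hgh]
  simp only [FreeGroup.norm] at *
  rw [hgh, List.length_append, List.drop_length_add_append]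
  exact and_congr_left fun _ => by omega

/-- A set of positions of pairwise disjoint occurrences of `w` in `g`. -/
def IsPacking (w g : FreeGroup S) (s : Finset ℕ) : Prop :=
  (∀ i ∈ s, OccursAt w g i) ∧ ∀ i ∈ s, ∀ j ∈ s, i < j → i + w.norm ≤ j

theorem IsPacking.card_le_norm {w g : FreeGroup S} {s : Finset ℕ} (h : IsPacking w g s) :
    s.card ≤ g.norm + 1 := by
  have : s ⊆ Finset.range (g.norm + 1) := fun i hi => by
    have := (occursAt_iff.1 (h.1 i hi)).1
    exact Finset.mem_range.2 (by omega)
  simpa using Finset.card_le_card this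

theorem IsPacking.card_le {w g : FreeGroup S} {s : Finset ℕ} (h : IsPacking w g s) :
    s.card ≤ smallCount w g :=
  le_csSup ⟨g.norm + 1, by rintro _ ⟨t, rfl, ht⟩; exact IsPacking.card_le_norm ht⟩ ⟨s, rfl, h⟩

theorem exists_isPacking (w g : FreeGroup S) : ∃ s, IsPacking w g s ∧ s.card = smallCount w g := by
  have : smallCount w g ∈ {n | ∃ s : Finset ℕ, s.card = n ∧ IsPacking w g s} :=
    Nat.sSup_mem ⟨0, ∅, rfl, by simp [IsPacking]⟩
      ⟨g.norm + 1, by rintro _ ⟨t, rfl, ht⟩; exact IsPacking.card_le_norm ht⟩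
  obtain ⟨s, h1, h2⟩ := this
  exact ⟨s, h2, h1⟩

theorem smallCount_le_inv (w g : FreeGroup S) : smallCount w g ≤ smallCount w⁻¹ g⁻¹ := by
  obtain ⟨s, hs, hc⟩ := exists_isPacking w g
  have hle : ∀ i ∈ s, i + w.norm ≤ g.norm := fun i hi => (occursAt_iff.1 (hs.1 i hi)).1
  -- Inversion reverses the word, so an occurrence is moved to the reflection of its end point.
  rw [← hc, ← Finset.card_image_of_injOn (f := fun i => g.norm - (i + w.norm)) (s := s)]
  · refine IsPacking.card_le ⟨?_, ?_⟩
    · intro i hi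
      obtain ⟨j, hj, rfl⟩ := Finset.mem_image.1 hi
      exact OccursAt.inv (hs.1 j hj)
    · intro i hi j hj hij
      obtain ⟨i', hi₀, rfl⟩ := Finset.mem_image.1 hi
      obtain ⟨j', hj₀, rfl⟩ := Finset.mem_image.1 hj
      have h1 := hle i' hi₀
      have h2 := hle j' hj₀
      rw [FreeGroup.norm_inv_eq]
      have := hs.2 j' hj₀ i' hi₀ (by omega)
      omega
  · intro i hi j hj hij
    have h1 := hle i hi
    have h2 := hle j hj
    simp only at hij
    omega

theorem smallCount_inv (w g : FreeGroup S) : smallCount w⁻¹ g⁻¹ = smallCount w g :=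
  le_antisymm (by simpa using smallCount_le_inv w⁻¹ g⁻¹) (smallCount_le_inv w g)

theorem brooks_inv (w g : FreeGroup S) : brooks w g⁻¹ = -brooks w g := by
  have h1 := smallCount_inv w g
  have h2 := smallCount_inv w⁻¹ g
  rw [inv_inv] at h2
  rw [brooks, brooks, h1, h2]
  ring

theorem smallCount_add_le {w g h : FreeGroup S} (hw : w ≠ 1)
    (hgh : (g * h).toWord = g.toWord ++ h.toWord) :
    smallCount w g + smallCount w h ≤ smallCount w (g * h) := by
  -- For the empty word, packings of `g` and of `h` could share the position of the cut.
  have hw0 : w.norm ≠ 0 := fun h => hw (FreeGroup.norm_eq_zero.1 h)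
  obtain ⟨s, hs, hsc⟩ := exists_isPacking w g
  obtain ⟨t, ht, htc⟩ := exists_isPacking w h
  have hle : ∀ i ∈ s, i + w.norm ≤ g.norm := fun i hi => (occursAt_iff.1 (hs.1 i hi)).1
  have htc' : (t.image (g.norm + ·)).card = t.card :=
    Finset.card_image_of_injective _ (add_right_injective _)
  rw [← hsc, ← htc, ← htc', ← Finset.card_union_of_disjoint]
  · refine IsPacking.card_le ⟨?_, ?_⟩
    · intro i hi
      rcases Finset.mem_union.1 hi with hi | hi
      · exact (occursAt_mul_left hgh (hle i hi)).2 (hs.1 i hi)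
      · obtain ⟨j, hj, rfl⟩ := Finset.mem_image.1 hi
        exact (occursAt_mul_right hgh).2 (ht.1 j hj)
    · intro i hi j hj hij
      rcases Finset.mem_union.1 hi with hi | hi <;> rcases Finset.mem_union.1 hj with hj | hj
      · exact hs.2 i hi j hj hij
      · obtain ⟨j', hj₀, rfl⟩ := Finset.mem_image.1 hj
        have := hle i hi
        omega
      · obtain ⟨i', hi₀, rfl⟩ := Finset.mem_image.1 hi
        have := hle j hj
        omega
      · obtain ⟨i', hi₀, rfl⟩ := Finset.mem_image.1 hi
        obtain ⟨j', hj₀, rfl⟩ := Finset.mem_image.1 hj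
        have := ht.2 i' hi₀ j' hj₀ (by omega)
        omega
  · rw [Finset.disjoint_left]
    intro i hi hi'
    obtain ⟨j, hj, rfl⟩ := Finset.mem_image.1 hi'
    have := hle _ hi
    omega

/-- An occurrence of `w` in `g` that has the cut after the first `n` letters in its interior. -/
def Crosses (w g : FreeGroup S) (n : ℕ) : Prop :=
  ∃ i, OccursAt w g i ∧ i < n ∧ n < i + w.norm

/-- A packing of `g * h` splits into occurrences in `g`, occurrences in `h`, and those across the
cut; disjointness allows at most one of the last kind. -/
theorem exists_smallCount_mul_le {w g h : FreeGroup S}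
    (hgh : (g * h).toWord = g.toWord ++ h.toWord) :
    ∃ k ≤ 1, smallCount w (g * h) ≤ smallCount w g + smallCount w h + k ∧
      (k ≠ 0 → Crosses w (g * h) g.norm) := by
  obtain ⟨s, hs, hsc⟩ := exists_isPacking w (g * h)
  set s₁ := s.filter fun i => i + w.norm ≤ g.norm with hs₁
  set s₂ := s.filter fun i => g.norm ≤ i with hs₂
  set s₃ := s.filter fun i => i < g.norm ∧ g.norm < i + w.norm with hs₃
  have h1 : s₁.card ≤ smallCount w g := IsPacking.card_le
    ⟨fun i hi => by
      obtain ⟨h1, h2⟩ := Finset.mem_filter.1 hi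
      exact (occursAt_mul_left hgh h2).1 (hs.1 i h1),
    fun i hi j hj => hs.2 i (Finset.mem_filter.1 hi).1 j (Finset.mem_filter.1 hj).1⟩
  have h2 : s₂.card ≤ smallCount w h := by
    rw [← Finset.card_image_of_injOn (f := fun i => i - g.norm) (s := s₂)]
    · refine IsPacking.card_le ⟨?_, ?_⟩
      · intro i hi
        obtain ⟨j, hj, rfl⟩ := Finset.mem_image.1 hi
        obtain ⟨h1, h2⟩ := Finset.mem_filter.1 hj
        refine (occursAt_mul_right hgh).1 ?_
        rw [Nat.add_sub_cancel' h2]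
        exact hs.1 j h1
      · intro i hi j hj hij
        obtain ⟨i', hi₀, rfl⟩ := Finset.mem_image.1 hi
        obtain ⟨j', hj₀, rfl⟩ := Finset.mem_image.1 hj
        obtain ⟨h1, h2⟩ := Finset.mem_filter.1 hi₀
        obtain ⟨h3, h4⟩ := Finset.mem_filter.1 hj₀
        have := hs.2 i' h1 j' h3 (by omega)
        omega
    · intro i hi j hj hij
      have h1 := (Finset.mem_filter.1 hi).2
      have h2 := (Finset.mem_filter.1 hj).2
      simp only at hij
      omega
  refine ⟨s₃.card, Finset.card_le_one.2 fun i hi j hj => ?_, ?_, fun hk => ?_⟩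
  · obtain ⟨h1, h2, h3⟩ := Finset.mem_filter.1 hi
    obtain ⟨h4, h5, h6⟩ := Finset.mem_filter.1 hj
    by_contra hij
    rcases Nat.lt_or_gt_of_ne hij with h | h
    · have := hs.2 i h1 j h4 h
      omega
    · have := hs.2 j h4 i h1 h
      omega
  · have hsub : s ⊆ s₁ ∪ s₂ ∪ s₃ := by
      intro i hi
      simp only [hs₁, hs₂, hs₃, Finset.mem_union, Finset.mem_filter, hi, true_and]
      omega
    have := (Finset.card_le_card hsub).trans (Finset.card_union_le _ _)
    have := Finset.card_union_le s₁ s₂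
    omega
  · obtain ⟨i, hi⟩ := Finset.card_ne_zero.1 hk
    obtain ⟨h1, h2⟩ := Finset.mem_filter.1 hi
    exact ⟨i, hs.1 i h1, h2⟩

/-- The second occurrence starts inside the first. Either it also ends there, or both start together
and `w` is a prefix of `w'`, or the two overlap properly. -/
theorem overlap_of_le {w w' g : FreeGroup S} {i j : ℕ} (hne : w ≠ w') (hi : OccursAt w g i)
    (hj : OccursAt w' g j) (hij : i ≤ j) (hji : j < i + w.norm) : Overlap w w' := by
  obtain ⟨h1, h2⟩ := occursAt_iff.1 hi
  obtain ⟨h3, h4⟩ := occursAt_iff.1 hj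
  have hdw : w.toWord.drop (j - i) = (g.toWord.drop j).take (i + w.norm - j) := by
    rw [← h2, List.drop_take, List.drop_drop]
    rw [show i + (j - i) = j by omega, show w.norm - (j - i) = i + w.norm - j by omega]
  by_cases hc : j + w'.norm ≤ i + w.norm
  · refine Or.inr (Or.inr ⟨hne, Or.inr ?_⟩)
    have : w'.toWord = (w.toWord.drop (j - i)).take w'.norm := by
      rw [hdw, List.take_take, min_eq_left (by omega), h4]
    rw [this]
    exact (List.take_prefix _ _).isInfix.trans (List.drop_suffix _ _).isInfix
  · have hdw' : w'.toWord.take (i + w.norm - j) = w.toWord.drop (j - i) := by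
      rw [hdw, ← h4, List.take_take, min_eq_left (by omega)]
    rcases hij.eq_or_lt with rfl | hlt
    · refine Or.inr (Or.inr ⟨hne, Or.inl ?_⟩)
      rw [Nat.sub_self, List.drop_zero] at hdw'
      rw [← hdw']
      exact (List.take_prefix _ _).isInfix
    · refine Or.inl ⟨w.toWord.take (j - i), w.toWord.drop (j - i),
        w'.toWord.drop (i + w.norm - j), ?_, ?_, ?_, by simp, by rw [← hdw']; simp⟩
      all_goals
        refine List.ne_nil_of_length_pos ?_
        simp only [List.length_take, List.length_drop, FreeGroup.norm] at *
        omega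

theorem Overlap.symm {w w' : FreeGroup S} (h : Overlap w w') : Overlap w' w := by
  rcases h with h | h | ⟨h1, h2⟩
  exacts [Or.inr (Or.inl h), Or.inl h, Or.inr (Or.inr ⟨h1.symm, h2.symm⟩)]

theorem Crosses.overlap {w w' g : FreeGroup S} {n : ℕ} (h : Crosses w g n) (h' : Crosses w' g n)
    (hne : w ≠ w') : Overlap w w' := by
  obtain ⟨i, hi, hin, hni⟩ := h
  obtain ⟨j, hj, hjn, hnj⟩ := h'
  rcases le_total i j with hij | hij
  · exact overlap_of_le hne hi hj hij (by omega)
  · exact (overlap_of_le hne.symm hj hi hij (by omega)).symm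

/-- The counts of `w` and of `w⁻¹` each grow by `0` or `1` on a reduced product and enter `h_w` with
opposite signs. -/
theorem abs_brooks_mul_le {w g h : FreeGroup S} (hw : w ≠ 1)
    (hgh : (g * h).toWord = g.toWord ++ h.toWord) :
    |brooks w g + brooks w h - brooks w (g * h)| ≤ 1 ∧
      (brooks w g + brooks w h - brooks w (g * h) ≠ 0 →
        Crosses w (g * h) g.norm ∨ Crosses w⁻¹ (g * h) g.norm) := by
  obtain ⟨k, hk, h1, hc⟩ := exists_smallCount_mul_le (w := w) hgh
  obtain ⟨k', hk', h1', hc'⟩ := exists_smallCount_mul_le (w := w⁻¹) hgh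
  have h2 := smallCount_add_le hw hgh
  have h2' := smallCount_add_le (inv_ne_one.2 hw) hgh
  simp only [brooks]
  constructor
  · rw [abs_le]
    constructor
    · have : (smallCount w (g * h) : ℝ) ≤ smallCount w g + smallCount w h + 1 := by
        exact_mod_cast (by omega :
          smallCount w (g * h) ≤ smallCount w g + smallCount w h + 1)
      have : (smallCount w⁻¹ g : ℝ) + smallCount w⁻¹ h ≤ smallCount w⁻¹ (g * h) := by
        exact_mod_cast h2'
      linarith
    · have : (smallCount w⁻¹ (g * h) : ℝ) ≤ smallCount w⁻¹ g + smallCount w⁻¹ h + 1 := by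
        exact_mod_cast (by omega :
          smallCount w⁻¹ (g * h) ≤ smallCount w⁻¹ g + smallCount w⁻¹ h + 1)
      have : (smallCount w g : ℝ) + smallCount w h ≤ smallCount w (g * h) := by
        exact_mod_cast h2
      linarith
  · intro hne
    by_contra! hcon
    have k0 : k = 0 := by_contra fun h => hcon.1 (hc h)
    have k0' : k' = 0 := by_contra fun h => hcon.2 (hc' h)
    have e1 : smallCount w (g * h) = smallCount w g + smallCount w h := by omega
    have e2 : smallCount w⁻¹ (g * h) = smallCount w⁻¹ g + smallCount w⁻¹ h := by omega
    apply hne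
    rw [e1, e2]
    push_cast
    ring

/-! ### Sums of Brooks quasimorphisms over independent families -/

theorem finite_brooks_ne_zero (g : FreeGroup S) : {w | brooks w g ≠ 0}.Finite := by
  have hfin : {w : FreeGroup S | w.toWord <:+: g.toWord}.Finite := by
    refine Set.Finite.of_finite_image (f := FreeGroup.toWord) ?_ toWord_injective.injOn
    refine (g.toWord.sublists.toFinset.finite_toSet).subset ?_
    rintro _ ⟨w, hw, rfl⟩
    simpa using hw.sublist
  have hpos : ∀ w : FreeGroup S, smallCount w g ≠ 0 → w.toWord <:+: g.toWord := by
    intro w hw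
    obtain ⟨s, hs, hc⟩ := exists_isPacking w g
    obtain ⟨i, hi⟩ := Finset.card_ne_zero.1 (hc ▸ hw)
    obtain ⟨u, v, -, h⟩ := hs.1 i hi
    exact ⟨u, v, h.symm⟩
  refine (hfin.union (hfin.preimage (f := (·⁻¹)) inv_injective.injOn)).subset ?_
  intro w hw
  by_contra hcon
  simp only [Set.mem_union, Set.mem_ofPred_eq, Set.mem_preimage, not_or] at hcon
  have h1 : smallCount w g = 0 := by_contra fun h => hcon.1 (hpos _ h)
  have h2 : smallCount w⁻¹ g = 0 := by_contra fun h => hcon.2 (hpos _ h)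
  exact hw (by simp [brooks, h1, h2])

theorem finsum_brooks_eq_sum (β : FreeGroup S → ℝ) {g : FreeGroup S} {U : Finset (FreeGroup S)}
    (hU : {w | brooks w g ≠ 0} ⊆ U) :
    ∑ᶠ w, β w * brooks w g = ∑ w ∈ U, β w * brooks w g :=
  finsum_eq_sum_of_support_subset _ fun _ hw => hU (right_ne_zero_of_mul hw)

/-- By independence a cut is crossed by at most one word `w₀` of `I`, so only the terms of `w₀` and
`w₀⁻¹` contribute to the defect, each by at most `C`. -/
theorem finsum_brooks_mem {β : FreeGroup S → ℝ} {C : ℝ} (hC : ∀ w, |β w| ≤ C)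
    {I : Set (FreeGroup S)} (hI : ∀ w ∈ I, w⁻¹ ∈ I) (hind : Independent I) (h1 : (1 : FreeGroup S) ∉ I)
    (hβ : Function.support β ⊆ I) :
    (fun g => ∑ᶠ w, β w * brooks w g) ∈ Quasimorphisms (FreeGroup S) := by
  refine mem_quasimorphisms_of_reduced (fun g => ?_) (2 * C) fun g h hgh => ?_
  · simp only [brooks_inv, mul_neg, finsum_neg_distrib]
  · classical
    have hC0 : 0 ≤ C := (abs_nonneg _).trans (hC 1)
    set U : Finset (FreeGroup S) := (finite_brooks_ne_zero g).toFinset ∪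
      (finite_brooks_ne_zero h).toFinset ∪ (finite_brooks_ne_zero (g * h)).toFinset with hU
    rw [finsum_brooks_eq_sum β (g := g) (U := U) (fun w hw => by simp_all),
      finsum_brooks_eq_sum β (g := h) (U := U) (fun w hw => by simp_all),
      finsum_brooks_eq_sum β (g := g * h) (U := U) (fun w hw => by simp_all),
      ← Finset.sum_add_distrib, ← Finset.sum_sub_distrib]
    obtain ⟨T, hT, hTc⟩ : ∃ T : Finset (FreeGroup S), T.card ≤ 2 ∧
        ∀ w ∈ I, Crosses w (g * h) g.norm ∨ Crosses w⁻¹ (g * h) g.norm → w ∈ T := by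
      by_cases hex : ∃ w₀ ∈ I, Crosses w₀ (g * h) g.norm
      · obtain ⟨w₀, hw₀, hc₀⟩ := hex
        refine ⟨{w₀, w₀⁻¹}, Finset.card_le_two, fun w hw hc => ?_⟩
        have : ∀ v ∈ I, Crosses v (g * h) g.norm → v = w₀ := fun v hv hc =>
          by_contra fun hne => hind v hv w₀ hw₀ (hc.overlap hc₀ hne)
        rcases hc with hc | hc
        · simp [this w hw hc]
        · simp [← this _ (hI w hw) hc]
      · refine ⟨∅, by simp, fun w hw hc => ?_⟩
        rcases hc with hc | hc
        exacts [(hex ⟨w, hw, hc⟩).elim, (hex ⟨_, hI w hw, hc⟩).elim]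
    have hterm : ∀ w, |β w * brooks w g + β w * brooks w h - β w * brooks w (g * h)| ≤
        if w ∈ T then C else 0 := by
      intro w
      rw [← mul_add, ← mul_sub, abs_mul]
      by_cases hw : w ∈ I
      · obtain ⟨hle, hcr⟩ := abs_brooks_mul_le (w := w) (fun h => h1 (h ▸ hw)) hgh
        by_cases hwT : w ∈ T
        · rw [if_pos hwT]
          exact (mul_le_mul (hC w) hle (abs_nonneg _) hC0).trans_eq (mul_one C)
        · have : brooks w g + brooks w h - brooks w (g * h) = 0 :=
            by_contra fun h => hwT (hTc w hw (hcr h))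
          simp [this, hwT]
      · have : β w = 0 := by_contra fun h => hw (hβ h)
        rw [this, abs_zero, zero_mul]
        split_ifs <;> simp [hC0]
    refine (Finset.abs_sum_le_sum_abs _ _).trans
      ((Finset.sum_le_sum fun w _ => hterm w).trans ?_)
    rw [← Finset.sum_filter, Finset.sum_const, nsmul_eq_mul]
    have : (U.filter (· ∈ T)).card ≤ 2 :=
      (Finset.card_le_card fun w hw => (Finset.mem_filter.1 hw).2).trans hT
    gcongr
    exact_mod_cast this

theorem IsSigmaInd.mem_quasimorphisms {φ : FreeGroup S → ℝ} (hφ : IsSigmaInd φ) :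
    φ ∈ Quasimorphisms (FreeGroup S) := by
  classical
  obtain ⟨n, α, P, -, hα, hφ⟩ := hφ
  -- The restriction to `P` is absorbed into the coefficients, which need not stay alternating: each
  -- `h_w` is alternating in `g` by itself.
  have heq : φ = ∑ i, fun g => ∑ᶠ w, P.indicator (α i) w * brooks w g := by
    funext g
    have hU : {w | brooks w g ≠ 0} ⊆ ((finite_brooks_ne_zero g).toFinset : Set (FreeGroup S)) :=
      fun w hw => by simpa using hw
    rw [hφ, finsum_mem_def, Finset.sum_apply]
    simp only [finsum_brooks_eq_sum _ hU]
    rw [Finset.sum_comm]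
    have : ∀ w, P.indicator (fun w => (∑ i, α i w) * brooks w g) w =
        P.indicator (fun w => ∑ i, α i w) w * brooks w g := fun w => by
      by_cases hw : w ∈ P <;> simp [hw]
    simp only [this, finsum_brooks_eq_sum _ hU]
    refine Finset.sum_congr rfl fun w _ => ?_
    by_cases hw : w ∈ P <;> simp [hw, Finset.sum_mul]
  rw [heq]
  refine Submodule.sum_mem _ fun i _ => ?_
  obtain ⟨⟨C, hC⟩, hinv, I, -, hind, hI⟩ := hα i
  -- The support is used as the family since it is symmetric and, as `α i` is alternating, excludes
  -- `1`.
  refine finsum_brooks_mem (I := Function.support (α i)) (C := C) (fun w => ?_)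
    (fun w hw => ?_) (fun w hw w' hw' => hind w (hI hw) w' (hI hw')) ?_ ?_
  · by_cases hw : w ∈ P
    · simpa [hw] using hC w
    · simpa [hw] using (abs_nonneg _).trans (hC w)
  · simpa [hinv] using hw
  · have := hinv 1
    rw [inv_one] at this
    simpa using (by linarith : α i 1 = 0)
  · intro w hw
    exact fun h => hw (by simp [Set.indicator, h])

end FreeDecomposition

open BoundedCohomology FreeDecomposition in
theorem mainTheorem5 {S : Type*} [Finite S] [Nontrivial S] [DecidableEq S]
    (hQ : ∀ φ ψ : Quasimorphisms (Monoid.Coprod (FreeGroup S) (FreeGroup S)),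
      cup (deltaClass φ) (deltaClass ψ) = 0 →
        cup (deltaClass (compIota φ)) (deltaClass (compIota ψ)) = 0) :
    (∀ (Δ : Decomposition S) (φ : FreeGroup S → ℝ), Δ.IsDecomposable φ →
      ∃ hφ : φ ∈ Quasimorphisms (FreeGroup S), ∀ ψ : Quasimorphisms (FreeGroup S),
        cup (deltaClass ⟨φ, hφ⟩) (deltaClass ψ) = 0) ∧
    (∀ φ : FreeGroup S → ℝ, IsSigmaInd φ →
      ∃ hφ : φ ∈ Quasimorphisms (FreeGroup S), ∀ ψ : Quasimorphisms (FreeGroup S),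
        cup (deltaClass ⟨φ, hφ⟩) (deltaClass ψ) = 0) ∧
    (∀ φ : FreeGroup S → ℝ, IsRolli φ →
      ∃ hφ : φ ∈ Quasimorphisms (FreeGroup S), ∀ ψ : Quasimorphisms (FreeGroup S),
        cup (deltaClass ⟨φ, hφ⟩) (deltaClass ψ) = 0) := by
  have hcup := cup_eq_zero_of_coprod hQ
  exact ⟨fun Δ φ hφ => ⟨hφ.mem_quasimorphisms, hcup _⟩,
    fun φ hφ => ⟨hφ.mem_quasimorphisms, hcup _⟩,
    fun φ hφ => ⟨hφ.mem_quasimorphisms, hcup _⟩⟩
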